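/- **Setting.** Let $u_0:\mathbb R^n\to\mathbb R^n$ and $\rho_0:\mathbb R^n\to(0,\infty)$ be bounded functions of class $C^1$. Let $W^1,W^2$ be independent standard $n$-dimensional Brownian motions. For constants $\sigma=(\sigma_1,\sigma_2)$ with $\sigma_1,\sigma_2\ge 0$ and $|\sigma|\neq0$, let $(X,U)$ solve $$dX=U\,dt+\sigma_1\,dW^1,\qquad dU=\sigma_2\,dW^2,$$ where $(X(0),U(0))$ is independent of $(W^1,W^2)$ and has the ($\sigma$-finite) initial distribution $\delta(u-u_0(x))\rho_0(x)\,dx\,du$. Let $P_\sigma(t,x,u)$ be the density of the joint distribution of $(X(t),U(t))$. This means: $P_\sigma(t,x,u)\,du$ is, for every $x$, a finite measure in $u$, depending weakly continuously on $x$, and the joint distribution of $(X(t),U(t))$ is $P_\sigma(t,x,u)\,du\,dx$. (For $\sigma_2=0$ it need not have a density in $u$.) Put $$\rho_\sigma(t,x)=\int_{\mathbb R^n}P_\sigma(t,x,u)\,du,\qquad u_\sigma(t,x)=\frac{\int_{\mathbb R^n}u\,P_\sigma(t,x,u)\,du}{\int_{\mathbb R^n}P_\sigma(t,x,u)\,du}.$$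 A classical solution on $[0,T)\times\mathbb R^n$, $0\le T\le\infty$, of the Burgers problem $$\partial_tu+(u,\nabla)u=0\quad(t>0),\qquad u(0,\cdot)=u_0,$$ is a function $u(t,x)\in\mathbb R^n$ with $u(0,\cdot)=u_0$ that is continuous for $0\le t<T$, of class $C^1$ for $0<t<T$, bounded in $x$ for each $t\in[0,T)$, and satisfies the equation for $0<t<T$. Let $t_*(u_0)\in[0,\infty]$ be the supremum of all $T$ for which such a solution exists. **Proposition 2.1.** For all $0\le t<t_*(u_0)$ and $x\in\mathbb R^n$ the equation $$u_0(s)\,t+s-x=0$$ has exactly one solution $s=s_0(t,x)\in\mathbb R^n$. The function $u(t,x)=u_0(s_0(t,x))$ is a classical solution of the Burgers problem on $[0,t_*(u_0))\times\mathbb R^n$, and every classical solution on some $[0,T)\times\mathbb R^n$ coincides with it there. For every fixed $(t,x)$ with $0<t<t_*(u_0)$ and every $\sigma$ as above, $P_\sigma(t,x,u)\,du$ exists and is unique, $\rho_\sigma(t,x)>0$, $\int|u|\,P_\sigma(t,x,u)\,du<\infty$, and $$\lim_{|\sigma|\to0}u_\sigma(t,x)=u_0(s_0(t,x)).$$ 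-/

import Mathlib

open MeasureTheory ProbabilityTheory Filter Topology
open scoped NNReal ENNReal BoundedContinuousFunction

namespace StochasticBurgers

/-- The space `ℝⁿ` with its Euclidean norm. -/
abbrev Vec (n : ℕ) : Type := EuclideanSpace ℝ (Fin n)

section Burgers

variable {n : ℕ}

/-- `u` is a classical solution on `[0, T) × ℝⁿ`, `T ≤ ∞`, of the Cauchy problem
`∂ₜ u + (u, ∇) u = 0` for `t > 0`, `u(0, ·) = u₀`: it is continuous up to `t = 0`, of class `C¹` for
`0 < t < T`, bounded in `x` at each time, and satisfies the equation pointwise. Note that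
`(u, ∇) u = ∑ᵢ uᵢ ∂ᵢ u` is the spatial derivative of `u` applied to the vector `u`. -/
structure IsClassicalSolution (u₀ : Vec n → Vec n) (T : ℝ≥0∞) (u : ℝ → Vec n → Vec n) : Prop where
  initial : ∀ x, u 0 x = u₀ x
  continuousOn : ContinuousOn (fun p : ℝ × Vec n => u p.1 p.2)
    {p | 0 ≤ p.1 ∧ ENNReal.ofReal p.1 < T}
  contDiffOn : ContDiffOn ℝ 1 (fun p : ℝ × Vec n => u p.1 p.2)
    {p | 0 < p.1 ∧ ENNReal.ofReal p.1 < T}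
  bounded : ∀ t : ℝ, 0 ≤ t → ENNReal.ofReal t < T → ∃ C : ℝ, ∀ x, ‖u t x‖ ≤ C
  equation : ∀ t : ℝ, 0 < t → ENNReal.ofReal t < T → ∀ x,
    deriv (fun τ => u τ x) t + fderiv ℝ (u t) x (u t x) = 0

/-- The time `t_*(u₀) ∈ [0, ∞]` up to which the solution of the Burgers equation stays smooth: the
supremum of all `T` such that there is a classical solution on `[0, T) × ℝⁿ`. -/
noncomputable def lifespan (u₀ : Vec n → Vec n) : ℝ≥0∞ :=
  sSup {T | ∃ u, IsClassicalSolution u₀ T u}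

end Burgers

section Noise

variable {n : ℕ} {Ω : Type*}

/-- `W¹` and `W²` are independent standard `n`-dimensional Brownian motions: their `2n` coordinates
are real standard Brownian motions, and these `2n` processes are independent. -/
structure IsBrownianPair [MeasurableSpace Ω] (W₁ W₂ : Fin n → ℝ≥0 → Ω → ℝ) (μ : Measure Ω) :
    Prop where
  brownian₁ : ∀ k, IsBrownianReal (W₁ k) μ
  brownian₂ : ∀ k, IsBrownianReal (W₂ k) μ
  indep : iIndepFun (fun (i : Fin n ⊕ Fin n) (ω : Ω) (t : ℝ≥0) =>
    Sum.elim (fun k => W₁ k t ω) (fun k => W₂ k t ω) i) μ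

/-- The vector `W(t) ∈ ℝⁿ`, for `t ≥ 0`. -/
noncomputable def vec (W : Fin n → ℝ≥0 → Ω → ℝ) (t : ℝ) (ω : Ω) : Vec n :=
  WithLp.toLp 2 fun k => W k t.toNNReal ω

/-- The solution `U` of `dU = σ₂ dW²`, `U(0) = u`. -/
noncomputable def velocity (σ : ℝ × ℝ) (W₂ : Fin n → ℝ≥0 → Ω → ℝ) (u : Vec n) (t : ℝ) (ω : Ω) :
    Vec n :=
  u + σ.2 • vec W₂ t ω

/-- The solution `X` of `dX = U dt + σ₁ dW¹`, `X(0) = x`, where `dU = σ₂ dW²`, `U(0) = u`. -/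
noncomputable def position (σ : ℝ × ℝ) (W₁ W₂ : Fin n → ℝ≥0 → Ω → ℝ) (x u : Vec n) (t : ℝ) (ω : Ω) :
    Vec n :=
  x + (∫ τ in (0 : ℝ)..t, velocity σ W₂ u τ ω) + σ.1 • vec W₁ t ω

/-- The joint distribution of `(X(t), U(t))` on `ℝⁿ × ℝⁿ` when `(X(0), U(0))` has the distribution
`δ(u - u₀(x)) ρ₀(x) dx du` and is independent of the Brownian motions. It is a `σ`-finite measure,
and a probability measure if `∫ ρ₀ = 1`. -/
noncomputable def jointLaw [MeasurableSpace Ω] (u₀ : Vec n → Vec n) (ρ₀ : Vec n → ℝ)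
    (W₁ W₂ : Fin n → ℝ≥0 → Ω → ℝ) (μ : Measure Ω) (σ : ℝ × ℝ) (t : ℝ) : Measure (Vec n × Vec n) :=
  (((volume : Measure (Vec n)).withDensity fun s => ENNReal.ofReal (ρ₀ s)).prod μ).map
    fun q => (position σ W₁ W₂ q.1 (u₀ q.1) t q.2, velocity σ W₂ (u₀ q.1) t q.2)

end Noise

section Density

variable {n : ℕ}

/-- `P x` is the finite measure `P(x, u) du` on the velocity space, for the density `P(x, u)` of the
measure `M` on `ℝⁿ × ℝⁿ`: one has `M(dx du) = P(x, du) dx`, and `P(x, du)` depends continuously on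
`x` in the sense of weak convergence of measures, which fixes it at every point `x`. (The
distribution of `U(t)` given `X(t) = x` need not have a density in `u` when `σ₂ = 0`, so `P(x, du)`
is kept as a measure in `u`.) -/
structure IsPhaseDensity (M : Measure (Vec n × Vec n)) (P : Vec n → Measure (Vec n)) : Prop where
  finite : ∀ x, IsFiniteMeasure (P x)
  continuous : ∀ f : Vec n →ᵇ ℝ, Continuous fun x => ∫ u, f u ∂P x
  disintegration : ∀ A B : Set (Vec n), MeasurableSet A → MeasurableSet B →
    M (A ×ˢ B) = ∫⁻ x in A, P x B

open Classical in
/-- The phase density of `M`, if there is one (and `0` otherwise). -/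
noncomputable def phaseDensity (M : Measure (Vec n × Vec n)) : Vec n → Measure (Vec n) :=
  if h : ∃ P, IsPhaseDensity M P then h.choose else 0

/-- `ρ_σ(t, x) = ∫ P(t, x, u) du`. -/
noncomputable def perturbedDensity {Ω : Type*} [MeasurableSpace Ω] (u₀ : Vec n → Vec n)
    (ρ₀ : Vec n → ℝ) (W₁ W₂ : Fin n → ℝ≥0 → Ω → ℝ) (μ : Measure Ω) (σ : ℝ × ℝ) (t : ℝ)
    (x : Vec n) : ℝ :=
  (phaseDensity (jointLaw u₀ ρ₀ W₁ W₂ μ σ t) x).real Set.univ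

/-- `u_σ(t, x) = ∫ u P(t, x, u) du / ∫ P(t, x, u) du`. -/
noncomputable def perturbedVelocity {Ω : Type*} [MeasurableSpace Ω] (u₀ : Vec n → Vec n)
    (ρ₀ : Vec n → ℝ) (W₁ W₂ : Fin n → ℝ≥0 → Ω → ℝ) (μ : Measure Ω) (σ : ℝ × ℝ) (t : ℝ)
    (x : Vec n) : Vec n :=
  (perturbedDensity u₀ ρ₀ W₁ W₂ μ σ t x)⁻¹ •
    ∫ u, u ∂phaseDensity (jointLaw u₀ ρ₀ W₁ W₂ μ σ t) x

end Density

/-- The admissible parameters: `σ₁, σ₂ ≥ 0` and `|σ| ≠ 0`. -/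
def admissible : Set (ℝ × ℝ) := {σ | 0 ≤ σ.1 ∧ 0 ≤ σ.2 ∧ σ ≠ 0}

end StochasticBurgers

/-! Deterministic half. A classical solution is constant along straight characteristics, which gives
`u(t, x) = u₀(x - t u(t, x))` (`IsClassicalSolution.eq_initial`). So `s = x - t u(t, x)` is a root
of `t u₀(s) + s = x`. It is the only one: `y ↦ y - t u(t, y)` is a right inverse of `s ↦ t u₀(s) +
s`, and it is onto, being open with bounded displacement (`surjective_of_isOpenMap_of_bounded`), so
every root has this form. Hence every solution equals `u₀` of the root, solutions on different time
intervals agree, and they glue to one on the whole lifespan.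

Stochastic half. The noise in `(X(t), U(t))` is Gaussian; its characteristic function is the limit
of those of Riemann sums (`integral_cexp_brownian`). Regressing the velocity noise on the position
noise (`map_noise`) writes it as `c` times the position noise plus an independent part `b Z`, with
`Z` standard Gaussian. Let `g_v` be the density of the position noise, of variance `v`. A particle
from `s` that arrives at `x` has position noise `x - s - t u₀(s)`, so `P(t, x, ·)` is the image of
`ρ₀(s) g_v(x - s - t u₀(s)) ds ⊗ law(Z)` under `(s, z) ↦ u₀(s) + c (x - s - t u₀(s)) + b z`
(`isPhaseDensity_explicitDensity`). Weak continuity makes it unique (`IsPhaseDensity.unique`).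

Limit. As `|σ| → 0` one has `v → 0`, and the weights `ρ₀(s) exp(-|x - s - t u₀(s)|² / (2v))`
concentrate at the unique zero `s₀(t, x)` of the exponent (`tendsto_laplace_ratio`). The coefficient
`c` need not converge, but it stays below `3 / (2t)` and multiplies a quantity that vanishes at
`s₀`. -/

namespace StochasticBurgers

/-! ### Classical solutions along characteristics. -/

section Characteristics

variable {n : ℕ} {u₀ : Vec n → Vec n} {T : ℝ≥0∞} {u : ℝ → Vec n → Vec n}

lemma isOpen_slab (T : ℝ≥0∞) :
    IsOpen {p : ℝ × Vec n | 0 < p.1 ∧ ENNReal.ofReal p.1 < T} :=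
  (isOpen_lt continuous_const continuous_fst).inter
    (isOpen_lt (ENNReal.continuous_ofReal.comp continuous_fst) continuous_const)

lemma IsClassicalSolution.hasFDerivAt (h : IsClassicalSolution u₀ T u) {t : ℝ} (ht : 0 < t)
    (htT : ENNReal.ofReal t < T) (x : Vec n) :
    HasFDerivAt (fun p : ℝ × Vec n => u p.1 p.2)
      (fderiv ℝ (fun p : ℝ × Vec n => u p.1 p.2) (t, x)) (t, x) :=
  ((h.contDiffOn.contDiffAt ((isOpen_slab T).mem_nhds ⟨ht, htT⟩)).differentiableAt
    one_ne_zero).hasFDerivAt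

lemma IsClassicalSolution.hasFDerivAt_right (h : IsClassicalSolution u₀ T u) {t : ℝ} (ht : 0 < t)
    (htT : ENNReal.ofReal t < T) (x : Vec n) :
    HasFDerivAt (u t) ((fderiv ℝ (fun p : ℝ × Vec n => u p.1 p.2) (t, x)).comp
      (ContinuousLinearMap.inr ℝ ℝ (Vec n))) x :=
  (h.hasFDerivAt ht htT x).comp x (hasFDerivAt_prodMk_right t x)

/-- The equation in terms of the total derivative. -/
lemma IsClassicalSolution.fderiv_apply (h : IsClassicalSolution u₀ T u) {t : ℝ} (ht : 0 < t)
    (htT : ENNReal.ofReal t < T) (x v : Vec n) :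
    fderiv ℝ (fun p : ℝ × Vec n => u p.1 p.2) (t, x) (1, v) =
      fderiv ℝ (fun p : ℝ × Vec n => u p.1 p.2) (t, x) (0, v - u t x) := by
  have h1 : HasDerivAt (fun τ => u τ x)
      (fderiv ℝ (fun p : ℝ × Vec n => u p.1 p.2) (t, x) (1, 0)) t := by
    exact (h.hasFDerivAt ht htT x).comp_hasDerivAt t
      ((hasDerivAt_id t).prodMk (hasDerivAt_const t x))
  have h2 := h.equation t ht htT x
  rw [h1.deriv, (h.hasFDerivAt_right ht htT x).fderiv] at h2
  simp only [ContinuousLinearMap.comp_apply, ContinuousLinearMap.inr_apply] at h2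
  have h3 : ((1 : ℝ), v) = (1, 0) + (0, u t x) + (0, v - u t x) := by simp
  rw [h3, map_add, map_add, h2, zero_add]

/-- A classical solution is constant along its characteristics. -/
lemma IsClassicalSolution.eq_initial (h : IsClassicalSolution u₀ T u) {t : ℝ} (ht : 0 ≤ t)
    (htT : ENNReal.ofReal t < T) (x : Vec n) : u t x = u₀ (x - t • u t x) := by
  rcases ht.eq_or_lt with rfl | ht
  · simp [h.initial]
  set v := u t x with hv
  let c : ℝ → Vec n := fun τ => x + (τ - t) • v
  have hc : Continuous c := by fun_prop
  have hlt : ∀ {τ : ℝ}, τ ≤ t → ENNReal.ofReal τ < T := fun hτ =>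
    (ENNReal.ofReal_le_ofReal hτ).trans_lt htT
  have hcont : ContinuousOn (fun τ => u τ (c τ)) (Set.Icc 0 t) :=
    h.continuousOn.comp (f := fun τ => (τ, c τ)) (by fun_prop)
      fun τ hτ => ⟨hτ.1, hlt hτ.2⟩
  -- By the equation, `y(τ) = u τ (c τ)` satisfies the linear ODE `y' = D_x u (v - y)`. The constant
  -- `v` solves it too, with the same value at `τ = t`, so backward uniqueness applies. The
  -- derivative of `u` is controlled only for positive times, hence the interval `[ε, t]`.
  have hconst : ∀ ε ∈ Set.Ioc 0 t, u ε (c ε) = v := by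
    intro ε hε
    have hsub : ∀ τ ∈ Set.Icc ε t, 0 < τ ∧ ENNReal.ofReal τ < T := fun τ hτ =>
      ⟨hε.1.trans_le hτ.1, hlt hτ.2⟩
    have hK : ContinuousOn (fun τ => fderiv ℝ (fun p : ℝ × Vec n => u p.1 p.2) (τ, c τ))
        (Set.Icc ε t) :=
      (h.contDiffOn.continuousOn_fderiv_of_isOpen (isOpen_slab T) le_rfl).comp
        (f := fun τ => (τ, c τ)) (by fun_prop) hsub
    obtain ⟨K, hK⟩ := isCompact_Icc.exists_bound_of_continuousOn hK
    have := ODE_solution_unique_of_mem_Icc_left (K := K.toNNReal) (s := fun _ => Set.univ)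
      (v := fun τ y => fderiv ℝ (fun p : ℝ × Vec n => u p.1 p.2) (τ, c τ) (0, v - y))
      (f := fun τ => u τ (c τ)) (g := fun _ => v) (a := ε) (b := t)
      ?_ (hcont.mono (Set.Icc_subset_Icc_left hε.1.le)) ?_ (fun _ _ => Set.mem_univ _)
      continuousOn_const ?_ (fun _ _ => Set.mem_univ _) (by simp [c, hv])
    · exact this ⟨le_rfl, hε.2⟩
    · intro τ hτ
      refine LipschitzOnWith.of_dist_le_mul fun y _ z _ => ?_
      rw [dist_eq_norm, ← map_sub, dist_eq_norm]
      refine (ContinuousLinearMap.le_opNorm _ _).trans ?_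
      refine mul_le_mul ((hK τ ⟨hτ.1.le, hτ.2⟩).trans (Real.le_coe_toNNReal K)) ?_
        (norm_nonneg _) (NNReal.coe_nonneg _)
      rw [Prod.mk_sub_mk, sub_zero, Prod.norm_mk, norm_zero, max_eq_right (norm_nonneg _),
        sub_sub_sub_cancel_left, norm_sub_rev]
    · intro τ hτ
      obtain ⟨h0, hT⟩ := hsub τ ⟨hτ.1.le, hτ.2⟩
      have hd : HasDerivAt (fun τ => (τ, c τ)) ((1 : ℝ), v) τ := by
        refine (hasDerivAt_id τ).prodMk ?_
        have := (((hasDerivAt_id τ).sub_const t).smul_const v).const_add x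
        simpa [c] using this
      have := (h.hasFDerivAt h0 hT (c τ)).comp_hasDerivAt τ hd
      rw [h.fderiv_apply h0 hT] at this
      exact this.hasDerivWithinAt
    · intro τ _
      rw [sub_self, Prod.mk_zero_zero, map_zero]
      exact hasDerivWithinAt_const τ (Set.Iic τ) v
  -- Continuity up to time `0` carries the constant value to the foot `c 0` of the characteristic.
  have hlim : Tendsto (fun τ => u τ (c τ)) (𝓝[>] 0) (𝓝 (u 0 (c 0))) := by
    have := (hcont 0 ⟨le_rfl, ht.le⟩).mono (Set.Ioc_subset_Icc_self)
    rwa [ContinuousWithinAt, nhdsWithin_Ioc_eq_nhdsGT ht] at this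
  have hlim' : Tendsto (fun τ => u τ (c τ)) (𝓝[>] 0) (𝓝 v) :=
    tendsto_const_nhds.congr' <| by
      filter_upwards [Ioc_mem_nhdsGT ht] with τ hτ using (hconst τ hτ).symm
  have := tendsto_nhds_unique hlim' hlim
  rw [h.initial] at this
  refine this.trans (congrArg u₀ ?_)
  simp [c, sub_eq_add_neg]

end Characteristics

/-! ### Global inversion of the characteristic map and gluing of solutions. -/

section Proper

variable {n : ℕ}

/-- A bounded perturbation of the identity that is a local homeomorphism is surjective. -/
lemma surjective_of_isOpenMap_of_bounded {φ : Vec n → Vec n} (hφ : Continuous φ)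
    (ho : IsOpenMap φ) {C : ℝ} (hC : ∀ x, ‖φ x - x‖ ≤ C) : Function.Surjective φ := by
  -- Bounded displacement makes preimages of bounded sets bounded, so `φ` is proper and its range
  -- closed. The range is also open, and the space is connected.
  have hclosed : IsClosed (Set.range φ) := by
    have : IsProperMap φ := by
      rw [isProperMap_iff_isCompact_preimage]
      refine ⟨hφ, fun K hK => ?_⟩
      obtain ⟨R, hR⟩ := hK.isBounded.exists_norm_le
      refine (isCompact_closedBall (0 : Vec n) (R + C)).of_isClosed_subset
        (hK.isClosed.preimage hφ) fun x hx => ?_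
      rw [mem_closedBall_zero_iff]
      have h1 := hR _ hx
      have h2 := hC x
      have h3 : ‖x‖ ≤ ‖φ x‖ + ‖φ x - x‖ := by
        have := norm_sub_le (φ x) (φ x - x)
        simpa using this
      linarith
    exact this.isClosedMap.isClosed_range
  have := IsClopen.eq_univ ⟨hclosed, ho.isOpen_range⟩ (Set.range_nonempty φ)
  exact Set.range_eq_univ.1 this

variable {u₀ : Vec n → Vec n} {T : ℝ≥0∞} {u : ℝ → Vec n → Vec n}

/-- With `Φ s = t u₀(s) + s` and `φ y = y - t u(t, y)`, constancy along characteristics says `Φ ∘ φ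
= id`. By the chain rule `Dφ` is injective, hence surjective in finite dimension, so `φ` is open;
boundedness of `u t` then makes it onto. A root `s` of `Φ s = x` is therefore some `φ y`, and `y = Φ
(φ y) = x`. -/
lemma IsClassicalSolution.eq_of_solves (h : IsClassicalSolution u₀ T u) (hu₀ : ContDiff ℝ 1 u₀)
    {t : ℝ} (ht : 0 ≤ t) (htT : ENNReal.ofReal t < T) {x s : Vec n}
    (hs : t • u₀ s + s - x = 0) : s = x - t • u t x := by
  rcases ht.eq_or_lt with rfl | ht'
  · simpa [sub_eq_zero] using hs
  let φ : Vec n → Vec n := fun y => y - t • u t y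
  let Φ : Vec n → Vec n := fun s => t • u₀ s + s
  have hΦ : ContDiff ℝ 1 Φ := (hu₀.const_smul t).add contDiff_id
  have hΦφ : ∀ y, Φ (φ y) = y := fun y => by
    simp only [Φ, φ, ← h.eq_initial ht htT y]
    abel
  have hut : ContDiff ℝ 1 (u t) := contDiff_iff_contDiffAt.2 fun y =>
    (h.contDiffOn.contDiffAt ((isOpen_slab T).mem_nhds ⟨ht', htT⟩)).comp y
      (contDiff_prodMk_right t).contDiffAt
  have hφ : ContDiff ℝ 1 φ := contDiff_id.sub (hut.const_smul t)
  have hopen : IsOpenMap φ := by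
    refine isOpenMap_iff_nhds_le.2 fun y => ?_
    have hstrict := hφ.contDiffAt.hasStrictFDerivAt (x := y) one_ne_zero
    have hcomp : (fderiv ℝ Φ (φ y)).comp (fderiv ℝ φ y) = ContinuousLinearMap.id ℝ (Vec n) := by
      have h1 := ((hΦ.differentiable one_ne_zero (φ y)).hasFDerivAt.comp y
        (hφ.differentiable one_ne_zero y).hasFDerivAt)
      have h2 : Φ ∘ φ = id := funext hΦφ
      rw [h2] at h1
      exact h1.unique (hasFDerivAt_id y)
    have hinj : Function.Injective (fderiv ℝ φ y : Vec n →ₗ[ℝ] Vec n) := fun a b hab => by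
      have h1 : ∀ a, fderiv ℝ Φ (φ y) (fderiv ℝ φ y a) = a := fun a => by
        simpa using congrArg (fun f => f a) hcomp
      have hab' : fderiv ℝ φ y a = fderiv ℝ φ y b := hab
      rw [← h1 a, ← h1 b, hab']
    have hsurj := LinearMap.surjective_of_injective hinj
    exact (hstrict.map_nhds_eq_of_surj (LinearMap.range_eq_top.2 hsurj)).ge
  obtain ⟨C, hC⟩ := h.bounded t ht htT
  have hsurj := surjective_of_isOpenMap_of_bounded hφ.continuous hopen (C := t * C) fun y => by
    simp only [φ, sub_sub_cancel_left, norm_neg, norm_smul, Real.norm_of_nonneg ht]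
    exact mul_le_mul_of_nonneg_left (hC y) ht
  obtain ⟨y, rfl⟩ := hsurj s
  have : Φ (φ y) = x := sub_eq_zero.1 hs
  rw [hΦφ] at this
  rw [← this]

lemma IsClassicalSolution.solves (h : IsClassicalSolution u₀ T u)
    {t : ℝ} (ht : 0 ≤ t) (htT : ENNReal.ofReal t < T) (x : Vec n) :
    t • u₀ (x - t • u t x) + (x - t • u t x) - x = 0 := by
  rw [← h.eq_initial ht htT x]
  abel

open Classical in
/-- A solution `s` of `t u₀(s) + s = x`, if there is one. -/
noncomputable def footPoint (u₀ : Vec n → Vec n) (t : ℝ) (x : Vec n) : Vec n :=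
  if h : ∃ s, t • u₀ s + s - x = 0 then h.choose else x

lemma footPoint_zero (u₀ : Vec n → Vec n) (x : Vec n) : footPoint u₀ 0 x = x := by
  unfold footPoint
  split_ifs with h
  · have := h.choose_spec
    rwa [zero_smul, zero_add, sub_eq_zero] at this
  · rfl

lemma IsClassicalSolution.footPoint_eq (h : IsClassicalSolution u₀ T u) (hu₀ : ContDiff ℝ 1 u₀)
    {t : ℝ} (ht : 0 ≤ t) (htT : ENNReal.ofReal t < T) (x : Vec n) :
    footPoint u₀ t x = x - t • u t x := by
  have hex : ∃ s, t • u₀ s + s - x = 0 := ⟨_, h.solves ht htT x⟩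
  rw [footPoint, dif_pos hex]
  exact h.eq_of_solves hu₀ ht htT hex.choose_spec

lemma IsClassicalSolution.eq_footPoint (h : IsClassicalSolution u₀ T u) (hu₀ : ContDiff ℝ 1 u₀)
    {t : ℝ} (ht : 0 ≤ t) (htT : ENNReal.ofReal t < T) (x : Vec n) :
    u t x = u₀ (footPoint u₀ t x) := by
  rw [h.footPoint_eq hu₀ ht htT, ← h.eq_initial ht htT]

lemma solves_iff_eq_footPoint (hu₀ : ContDiff ℝ 1 u₀) {t : ℝ} (ht : 0 ≤ t)
    (htT : ENNReal.ofReal t < lifespan u₀) (x s : Vec n) :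
    t • u₀ s + s - x = 0 ↔ s = footPoint u₀ t x := by
  obtain ⟨T, ⟨u, h⟩, hT⟩ := lt_sSup_iff.1 htT
  rw [h.footPoint_eq hu₀ ht hT]
  exact ⟨h.eq_of_solves hu₀ ht hT, fun hs => hs ▸ h.solves ht hT x⟩

/-- The supremum defining the lifespan need not be attained a priori. But each time below it lies in
the interval of some solution, and near that time this solution coincides with `u₀ ∘ footPoint`. All
the conditions are local in time, so they transfer. -/
lemma isClassicalSolution_footPoint (hu₀ : ContDiff ℝ 1 u₀) (hbdd : ∃ C : ℝ, ∀ x, ‖u₀ x‖ ≤ C) :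
    IsClassicalSolution u₀ (lifespan u₀) fun t x => u₀ (footPoint u₀ t x) where
  initial x := by rw [footPoint_zero]
  continuousOn := by
    rintro p ⟨hp, hpT⟩
    obtain ⟨T, ⟨u, h⟩, hT⟩ := lt_sSup_iff.1 hpT
    have hmem : {q : ℝ × Vec n | ENNReal.ofReal q.1 < T} ∈ 𝓝 p :=
      (isOpen_lt (ENNReal.continuous_ofReal.comp continuous_fst) continuous_const).mem_nhds hT
    have h1 : ContinuousWithinAt (fun p : ℝ × Vec n => u p.1 p.2)
        ({p | 0 ≤ p.1 ∧ ENNReal.ofReal p.1 < lifespan u₀} ∩ {q | ENNReal.ofReal q.1 < T}) p :=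
      (h.continuousOn p ⟨hp, hT⟩).mono fun q hq => ⟨hq.1.1, hq.2⟩
    refine (continuousWithinAt_inter hmem).1 (h1.congr (fun q hq => ?_) ?_)
    · exact (h.eq_footPoint hu₀ hq.1.1 hq.2 _).symm
    · exact (h.eq_footPoint hu₀ hp hT _).symm
  contDiffOn := by
    rintro p ⟨hp, hpT⟩
    obtain ⟨T, ⟨u, h⟩, hT⟩ := lt_sSup_iff.1 hpT
    have hmem := (isOpen_slab (n := n) T).mem_nhds (x := p) ⟨hp, hT⟩
    refine ((h.contDiffOn.contDiffAt hmem).congr_of_eventuallyEq ?_).contDiffWithinAt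
    filter_upwards [hmem] with q hq using (h.eq_footPoint hu₀ hq.1.le hq.2 _).symm
  bounded t _ _ := hbdd.imp fun C hC x => hC _
  equation t ht htT x := by
    obtain ⟨T, ⟨u, h⟩, hT⟩ := lt_sSup_iff.1 htT
    have h1 : (fun τ => u₀ (footPoint u₀ τ x)) =ᶠ[𝓝 t] fun τ => u τ x := by
      have hcont : Continuous fun τ : ℝ => (τ, x) := by fun_prop
      filter_upwards [((isOpen_slab (n := n) T).preimage hcont).mem_nhds
        (x := t) ⟨ht, hT⟩] with τ hτ using (h.eq_footPoint hu₀ hτ.1.le hτ.2 _).symm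
    have h2 : (fun y => u₀ (footPoint u₀ t y)) = u t :=
      funext fun y => (h.eq_footPoint hu₀ ht.le hT y).symm
    rw [h1.deriv_eq, h2, ← h.eq_footPoint hu₀ ht.le hT x]
    exact h.equation t ht hT x

end Proper

/-! ### Riemann sums and the sums needed for their covariances. -/

section RiemannSums

lemma tendsto_riemannSum {f : ℝ → ℝ} (hf : Continuous f) (t : ℝ≥0) :
    Tendsto (fun N : ℕ => ((t : ℝ) / N) * ∑ j ∈ Finset.range N, f ((t : ℝ) / N * (j + 1))) atTop
      (𝓝 (∫ τ in (0 : ℝ)..t, f τ)) := by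
  rw [Metric.tendsto_atTop]
  intro ε hε
  have huc : UniformContinuousOn f (Set.Icc 0 (t : ℝ)) :=
    isCompact_Icc.uniformContinuousOn_of_continuous hf.continuousOn
  -- An oscillation of `ε / (2(t + 1))` over total length `t` costs at most `ε / 2`; the `+ 1`
  -- covers `t = 0`.
  obtain ⟨δ, hδ, h⟩ := Metric.uniformContinuousOn_iff.1 huc (ε / (2 * (t + 1))) (by positivity)
  obtain ⟨N₀, hN₀⟩ := exists_nat_gt ((t : ℝ) / δ)
  refine ⟨N₀ + 1, fun N hN => ?_⟩
  have hN' : (0 : ℝ) < N := by exact_mod_cast (Nat.succ_pos _).trans_le hN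
  have hNδ : (t : ℝ) / N < δ := by
    have : (N₀ : ℝ) ≤ N := by exact_mod_cast (Nat.le_succ _).trans hN
    rw [div_lt_iff₀ hN']
    rw [div_lt_iff₀ hδ] at hN₀
    nlinarith
  have ht0 : (0 : ℝ) ≤ t / N := by positivity
  let a : ℕ → ℝ := fun j => (t : ℝ) / N * j
  have hstep : ∀ j, a (j + 1) - a j = t / N := fun j => by simp only [a]; push_cast; ring
  have hmono : ∀ j, a j ≤ a (j + 1) := fun j => by linarith [hstep j]
  have hsplit : ∫ τ in (0 : ℝ)..t, f τ = ∑ j ∈ Finset.range N, ∫ τ in a j..a (j + 1), f τ := by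
    rw [intervalIntegral.sum_integral_adjacent_intervals fun j _ => hf.intervalIntegrable _ _]
    simp only [a, Nat.cast_zero, mul_zero]
    rw [div_mul_cancel₀ _ hN'.ne']
  have hterm : ∀ j ∈ Finset.range N,
      ‖(t : ℝ) / N * f ((t : ℝ) / N * (j + 1)) - ∫ τ in a j..a (j + 1), f τ‖ ≤
        ε / (2 * (t + 1)) * (t / N) := by
    intro j hj
    have hj' : a (j + 1) ≤ t := by
      have : ((j + 1 : ℕ) : ℝ) ≤ N := by exact_mod_cast Finset.mem_range.1 hj
      calc a (j + 1) ≤ t / N * N := mul_le_mul_of_nonneg_left this ht0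
        _ = t := div_mul_cancel₀ _ hN'.ne'
    have ha0 : 0 ≤ a j := by positivity
    have h1 : (t : ℝ) / N * f ((t : ℝ) / N * (j + 1)) = ∫ _ in a j..a (j + 1), f (a (j + 1)) := by
      rw [intervalIntegral.integral_const, hstep, smul_eq_mul]
      simp [a]
    rw [h1, ← intervalIntegral.integral_sub (by simp) (hf.intervalIntegrable _ _)]
    refine (intervalIntegral.norm_integral_le_of_norm_le_const (C := ε / (2 * (t + 1)))
      fun τ hτ => ?_).trans (by rw [hstep, abs_of_nonneg ht0])
    rw [Set.uIoc_of_le (hmono j)] at hτ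
    refine (h _ ⟨ha0.trans (hmono j), hj'⟩ τ ⟨ha0.trans hτ.1.le, hτ.2.trans hj'⟩ ?_).le
    rw [Real.dist_eq, abs_of_nonneg (sub_nonneg.2 hτ.2)]
    linarith [hstep j, hτ.1]
  rw [dist_eq_norm, hsplit, Finset.mul_sum, ← Finset.sum_sub_distrib]
  refine (norm_sum_le_of_le _ hterm).trans_lt ?_
  rw [Finset.sum_const, Finset.card_range, nsmul_eq_mul]
  have : (N : ℝ) * (ε / (2 * (t + 1)) * (t / N)) = ε / 2 * (t / (t + 1)) := by
    field_simp
  rw [this]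
  have : (t : ℝ) / (t + 1) ≤ 1 := by
    rw [div_le_one (by positivity)]
    linarith
  nlinarith

lemma sum_range_add_one (N : ℕ) :
    ∑ j ∈ Finset.range N, ((j : ℝ) + 1) = N * (N + 1) / 2 := by
  induction N with
  | zero => simp
  | succ N ih => rw [Finset.sum_range_succ, ih]; push_cast; ring

/-- Up to scaling, `min` is the Brownian covariance at the nodes. Bordering the square by one row
and one column adds `(N + 1)²`, so this is the sum of the first `N` squares. -/
lemma sum_sum_range_min (N : ℕ) :
    ∑ i ∈ Finset.range N, ∑ j ∈ Finset.range N, min ((i : ℝ) + 1) (j + 1) =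
      N * (N + 1) * (2 * N + 1) / 6 := by
  induction N with
  | zero => simp
  | succ N ih =>
    have h1 : ∀ i ∈ Finset.range N, min ((i : ℝ) + 1) (N + 1) = i + 1 := fun i hi => by
      rw [min_eq_left]
      have : (i : ℝ) ≤ N := by exact_mod_cast (Finset.mem_range.1 hi).le
      linarith
    have h2 : ∀ j ∈ Finset.range N, min ((N : ℝ) + 1) (j + 1) = j + 1 := fun j hj => by
      rw [min_comm, h1 j hj]
    rw [Finset.sum_range_succ]
    simp_rw [Finset.sum_range_succ _ N]
    rw [Finset.sum_add_distrib, ih, Finset.sum_congr rfl h1, Finset.sum_congr rfl h2,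
      sum_range_add_one, min_self]
    push_cast
    ring

end RiemannSums

/-! ### Joint law of Brownian motions and their time integrals. -/

section Brownian

variable {Ω : Type*} [MeasurableSpace Ω] {μ : Measure Ω}

/-- The Riemann sum of `α ∫₀ᵗ B(τ) dτ + β B(t)` with `N` equal steps. -/
noncomputable def brownianSum (α β : ℝ) (t : ℝ≥0) (N : ℕ) (b : ℝ≥0 → ℝ) : ℝ :=
  α * (t / N) * ∑ j ∈ Finset.range N, b (t / N * (j + 1)) + β * b t

lemma measurable_brownianSum (α β : ℝ) (t : ℝ≥0) (N : ℕ) :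
    Measurable (brownianSum α β t N) := by
  unfold brownianSum
  fun_prop

/-- The sum is a linear functional of finitely many values of a Gaussian process. The time integral
is not, which is why it is reached through these sums. -/
lemma hasGaussianLaw_brownianSum {B : ℝ≥0 → Ω → ℝ} (hB : IsPreBrownianReal B μ)
    (α β : ℝ) (t : ℝ≥0) (N : ℕ) :
    HasGaussianLaw (fun ω => brownianSum α β t N (B · ω)) μ := by
  classical
  let p : ℕ → ℝ≥0 := fun j => t / N * (j + 1)
  let I : Finset ℝ≥0 := insert t ((Finset.range N).image p)
  have hp : ∀ j : Finset.range N, p j ∈ I := fun j =>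
    Finset.mem_insert_of_mem (Finset.mem_image_of_mem p j.2)
  let L : (I → ℝ) →L[ℝ] ℝ :=
    (α * (t / N)) • ∑ j : Finset.range N, ContinuousLinearMap.proj (⟨p j, hp j⟩ : I) +
      β • ContinuousLinearMap.proj (⟨t, Finset.mem_insert_self _ _⟩ : I)
  have := (hB.isGaussianProcess.hasGaussianLaw I).map L
  convert! this using 1
  ext ω
  simp only [brownianSum, L, Function.comp_apply, add_apply, smul_apply,
    sum_apply, ContinuousLinearMap.proj_apply, Finset.restrict, smul_eq_mul]
  rw [← Finset.sum_attach (Finset.range N)]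
  rfl

lemma integral_brownianSum {B : ℝ≥0 → Ω → ℝ} (hB : IsPreBrownianReal B μ)
    (α β : ℝ) (t : ℝ≥0) (N : ℕ) : ∫ ω, brownianSum α β t N (B · ω) ∂μ = 0 := by
  unfold brownianSum
  rw [integral_add, integral_const_mul, integral_const_mul, integral_finsetSum]
  · simp [hB.integral_eval]
  · exact fun _ _ => hB.integrable_eval _
  · exact (integrable_finsetSum _ fun _ _ => hB.integrable_eval _).const_mul _
  · exact (hB.integrable_eval _).const_mul _

lemma variance_brownianSum {B : ℝ≥0 → Ω → ℝ} (hB : IsPreBrownianReal B μ)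
    (α β : ℝ) (t : ℝ≥0) {N : ℕ} (hN : N ≠ 0) :
    Var[fun ω => brownianSum α β t N (B · ω); μ] =
      α ^ 2 * (t ^ 3 * ((1 + 1 / N) * (2 + 1 / N) / 6)) + α * β * (t ^ 2 * (1 + 1 / N))
        + β ^ 2 * t := by
  have := hB.isGaussianProcess.isProbabilityMeasure
  have hL : ∀ s, MemLp (B s) 2 μ := fun s => (hB.isGaussianProcess.hasGaussianLaw_eval s).memLp_two
  let p : ℕ → ℝ≥0 := fun j => t / N * (j + 1)
  have hSL : MemLp (fun ω => ∑ j ∈ Finset.range N, B (p j) ω) 2 μ :=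
    memLp_finsetSum _ fun _ _ => hL _
  have hN' : (N : ℝ) ≠ 0 := by exact_mod_cast hN
  have h1 : Var[fun ω => ∑ j ∈ Finset.range N, B (p j) ω; μ] =
      t / N * (N * (N + 1) * (2 * N + 1) / 6) := by
    rw [← covariance_self hSL.aemeasurable,
      covariance_fun_sum_fun_sum' (fun _ _ => hL _) (fun _ _ => hL _), ← sum_sum_range_min,
      Finset.mul_sum]
    refine Finset.sum_congr rfl fun i _ => ?_
    rw [Finset.mul_sum]
    refine Finset.sum_congr rfl fun j _ => ?_
    rw [hB.covariance_fun_eval, ← mul_min]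
    push_cast
    ring
  have h2 : cov[fun ω => ∑ j ∈ Finset.range N, B (p j) ω, B t; μ] = t * (N + 1) / 2 := by
    rw [covariance_fun_sum_left' (fun _ _ => hL _) (hL _)]
    have : ∀ j ∈ Finset.range N, cov[fun ω => B (p j) ω, B t; μ] = (t : ℝ) / N * (j + 1) := by
      intro j hj
      have hle : p j ≤ t := by
        rw [← NNReal.coe_le_coe]
        have : ((j : ℝ) + 1) ≤ N := by exact_mod_cast Finset.mem_range.1 hj
        calc ((p j : ℝ≥0) : ℝ) = t / N * (j + 1) := by simp [p]
          _ ≤ t / N * N := by gcongr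
          _ = t := div_mul_cancel₀ _ hN'
      rw [hB.covariance_fun_eval, min_eq_left hle]
      simp [p]
    rw [Finset.sum_congr rfl this, ← Finset.mul_sum, sum_range_add_one]
    field_simp
  unfold brownianSum
  rw [variance_fun_add (hSL.const_mul _) ((hL t).const_mul _), variance_const_mul,
    variance_const_mul, covariance_const_mul_left, covariance_const_mul_right, h1, h2,
    (hB.hasLaw_eval t).variance_eq, variance_id_gaussianReal]
  field_simp

/-- The variance of `α ∫₀ᵗ B(τ) dτ + β B(t)`. -/
noncomputable def brownianVariance (α β t : ℝ) : ℝ := α ^ 2 * (t ^ 3 / 3) + α * β * t ^ 2 + β ^ 2 * t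

lemma tendsto_variance_brownianSum {B : ℝ≥0 → Ω → ℝ} (hB : IsPreBrownianReal B μ)
    (α β : ℝ) (t : ℝ≥0) :
    Tendsto (fun N => Var[fun ω => brownianSum α β t N (B · ω); μ]) atTop
      (𝓝 (brownianVariance α β t)) := by
  have h0 : Tendsto (fun N : ℕ => 1 / (N : ℝ)) atTop (𝓝 0) := tendsto_one_div_atTop_nhds_zero_nat
  have h : Tendsto (fun N : ℕ => α ^ 2 * ((t : ℝ) ^ 3 * ((1 + 1 / (N : ℝ)) * (2 + 1 / N) / 6))
      + α * β * (t ^ 2 * (1 + 1 / N)) + β ^ 2 * t) atTop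
      (𝓝 (α ^ 2 * ((t : ℝ) ^ 3 * ((1 + 0) * (2 + 0) / 6))
      + α * β * (t ^ 2 * (1 + 0)) + β ^ 2 * t)) := by
    have h1 := h0.const_add 1
    have h2 := h0.const_add 2
    exact ((((h1.mul h2).div_const 6).const_mul _ |>.const_mul _).add
      ((h1.const_mul _).const_mul _)).add_const _
  have he : α ^ 2 * ((t : ℝ) ^ 3 * ((1 + 0) * (2 + 0) / 6)) + α * β * (t ^ 2 * (1 + 0))
      + β ^ 2 * t = brownianVariance α β t := by
    unfold brownianVariance
    ring
  rw [he] at h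
  refine h.congr' ?_
  filter_upwards [eventually_ne_atTop 0] with N hN using (variance_brownianSum hB α β t hN).symm

lemma tendsto_brownianSum {b : ℝ≥0 → ℝ} (hb : Continuous b) (α β : ℝ) (t : ℝ≥0) :
    Tendsto (fun N => brownianSum α β t N b) atTop
      (𝓝 (α * (∫ τ in (0 : ℝ)..t, b τ.toNNReal) + β * b t)) := by
  have h := tendsto_riemannSum (hb.comp continuous_real_toNNReal) t
  refine ((h.const_mul α).add_const (β * b t)).congr fun N => ?_
  have : ∀ j : ℕ, ((t : ℝ) / N * (j + 1)).toNNReal = t / N * (j + 1) := fun j => by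
    rw [← Real.toNNReal_coe (r := t / N * (j + 1))]
    push_cast
    rfl
  simp only [brownianSum, Function.comp_apply, this, mul_assoc]

/-- The characteristic function of a sum of independent variables `αᵢ ∫₀ᵗ Bᵢ(τ) dτ + βᵢ Bᵢ(t)`. -/
theorem integral_cexp_brownian {ι : Type*} [Fintype ι] [IsProbabilityMeasure μ]
    {W : ι → ℝ≥0 → Ω → ℝ} (hW : ∀ i, IsBrownianReal (W i) μ)
    (hind : iIndepFun (fun i ω (t : ℝ≥0) => W i t ω) μ) (α β : ι → ℝ) (t : ℝ≥0) :
    ∫ ω, Complex.exp ((∑ i, (α i * (∫ τ in (0 : ℝ)..t, W i τ.toNNReal ω) + β i * W i t ω) : ℝ) *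
      Complex.I) ∂μ = Complex.exp (-(∑ i, brownianVariance (α i) (β i) t : ℝ) / 2) := by
  let X : ℕ → ι → Ω → ℝ := fun N i ω => brownianSum (α i) (β i) t N (W i · ω)
  have hG : ∀ N i, HasGaussianLaw (X N i) μ := fun N i =>
    hasGaussianLaw_brownianSum (hW i).toIsPreBrownianReal _ _ _ _
  have hm : ∀ N i, AEMeasurable (X N i) μ := fun N i => (hG N i).aemeasurable
  have hXN : ∀ N, ∫ ω, Complex.exp ((∑ i, X N i ω : ℝ) * Complex.I) ∂μ =
      Complex.exp (-(∑ i, Var[X N i; μ] : ℝ) / 2) := by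
    intro N
    have hi : iIndepFun (X N) μ :=
      hind.comp (fun i => brownianSum (α i) (β i) t N) fun i => measurable_brownianSum _ _ _ _
    -- Frequency `1` suffices, since the arbitrary coefficients `α` and `β` already carry the
    -- frequency.
    have h1 := congrFun (iIndepFun.charFun_map_fun_sum_eq_prod (hm N) hi) 1
    rw [charFun_apply_real, integral_map (Finset.aemeasurable_fun_sum _ fun i _ => hm N i)
      (by fun_prop), Finset.prod_apply] at h1
    have h2 : ∀ i, charFun (μ.map (X N i)) 1 = Complex.exp (-(Var[X N i; μ] : ℝ) / 2) := fun i => by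
      rw [(hG N i).map_eq_gaussianReal, charFun_gaussianReal,
        integral_brownianSum (hW i).toIsPreBrownianReal, Real.coe_toNNReal _ (variance_nonneg _ _)]
      congr 1
      push_cast
      ring
    simp only [h2] at h1
    rw [← Complex.exp_sum] at h1
    simp only [Complex.ofReal_one, one_mul] at h1
    rw [h1]
    congr 1
    push_cast
    rw [← Finset.sum_div, Finset.sum_neg_distrib]
  have hcont : ∀ᵐ ω ∂μ, ∀ i, Continuous (W i · ω) := ae_all_iff.2 fun i => (hW i).cont
  have hlim1 : Tendsto (fun N => ∫ ω, Complex.exp ((∑ i, X N i ω : ℝ) * Complex.I) ∂μ) atTop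
      (𝓝 (∫ ω, Complex.exp ((∑ i, (α i * (∫ τ in (0 : ℝ)..t, W i τ.toNNReal ω) + β i * W i t ω) :
        ℝ) * Complex.I) ∂μ)) := by
    refine tendsto_integral_of_dominated_convergence (fun _ => 1) (fun N => ?_)
      (integrable_const _) (fun N => ?_) ?_
    · have : AEMeasurable (fun ω => ∑ i, X N i ω) μ :=
        Finset.aemeasurable_fun_sum _ fun i _ => hm N i
      exact (Complex.measurable_exp.comp_aemeasurable
        ((Complex.measurable_ofReal.comp_aemeasurable this).mul_const _)).aestronglyMeasurable
    · exact Eventually.of_forall fun ω => (Complex.norm_exp_ofReal_mul_I _).le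
    · filter_upwards [hcont] with ω hω
      have := tendsto_finsetSum Finset.univ fun i _ => tendsto_brownianSum (hω i) (α i) (β i) t
      exact (Complex.continuous_exp.tendsto _).comp
        (((Complex.continuous_ofReal.tendsto _).comp this).mul_const _)
  have hlim2 : Tendsto (fun N => Complex.exp (-(∑ i, Var[X N i; μ] : ℝ) / 2)) atTop
      (𝓝 (Complex.exp (-(∑ i, brownianVariance (α i) (β i) t : ℝ) / 2))) := by
    have := tendsto_finsetSum Finset.univ fun i _ =>
      tendsto_variance_brownianSum (hW i).toIsPreBrownianReal (α i) (β i) t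
    exact (Complex.continuous_exp.tendsto _).comp
      ((((Complex.continuous_ofReal.tendsto _).comp this).neg).div_const _)
  refine tendsto_nhds_unique hlim1 ?_
  simpa only [hXN] using hlim2

/-- The time integral of a Brownian motion is a random variable. -/
lemma aemeasurable_integral_brownian {B : ℝ≥0 → Ω → ℝ} (hB : IsBrownianReal B μ) (t : ℝ≥0) :
    AEMeasurable (fun ω => ∫ τ in (0 : ℝ)..t, B τ.toNNReal ω) μ := by
  refine aemeasurable_of_tendsto_metrizable_ae atTop
    (f := fun N ω => brownianSum 1 0 t N (B · ω))
    (fun N => (hasGaussianLaw_brownianSum hB.toIsPreBrownianReal 1 0 t N).aemeasurable) ?_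
  filter_upwards [hB.cont] with ω hω
  simpa using tendsto_brownianSum hω 1 0 t

end Brownian

/-! ### Uniqueness of the phase density at every point. -/

section Uniqueness

variable {n : ℕ} {M : Measure (Vec n × Vec n)} {P P' : Vec n → Measure (Vec n)}

lemma IsPhaseDensity.continuous_lintegral (h : IsPhaseDensity M P) (f : Vec n →ᵇ ℝ≥0) :
    Continuous fun x => ∫⁻ u, f u ∂P x := by
  have := h.finite
  have hc := ENNReal.continuous_ofReal.comp (h.continuous
    ⟨⟨fun u => (f u : ℝ), by fun_prop⟩, f.map_bounded'⟩)
  refine hc.congr fun x => ?_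
  rw [lintegral_coe_eq_integral]
  · rfl
  · exact (BoundedContinuousFunction.integrable (P x)
      (⟨⟨fun u => (f u : ℝ), by fun_prop⟩, f.map_bounded'⟩ : Vec n →ᵇ ℝ))

/-- Measurability in `x` comes from weak continuity: the indicator of a closed set is a limit of
bounded continuous functions, and closed sets form a generating π-system. -/
lemma IsPhaseDensity.measurable (h : IsPhaseDensity M P) : Measurable P := by
  have := h.finite
  have hclosed : ∀ F : Set (Vec n), IsClosed F → Measurable fun x => P x F := fun F hF => by
    refine measurable_of_tendsto_metrizable (fun k => (h.continuous_lintegral (hF.apprSeq k)).measurable)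
      (tendsto_pi_nhds.2 fun x => ?_)
    exact HasOuterApproxClosed.tendsto_lintegral_apprSeq hF (P x)
  exact .measure_of_isPiSystem (BorelSpace.measurable_eq.trans borel_eq_generateFrom_isClosed)
    isPiSystem_isClosed hclosed (hclosed _ isClosed_univ)

lemma IsPhaseDensity.ae_eq_apply (h : IsPhaseDensity M P) (h' : IsPhaseDensity M P')
    {B : Set (Vec n)} (hB : MeasurableSet B) : ∀ᵐ x, P x B = P' x B :=
  ae_eq_of_forall_setLIntegral_eq_of_sigmaFinite
    ((Measure.measurable_coe hB).comp h.measurable) ((Measure.measurable_coe hB).comp h'.measurable)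
    fun A hA _ => by
      rw [← h.disintegration A B hA hB, ← h'.disintegration A B hA hB]

/-- The phase density is determined at every point. -/
theorem IsPhaseDensity.unique (h : IsPhaseDensity M P) (h' : IsPhaseDensity M P') : P = P' := by
  funext x
  have := h.finite
  refine ext_of_forall_lintegral_eq_of_IsFiniteMeasure fun f => ?_
  have hm : Measurable fun u => (f u : ℝ≥0∞) := by fun_prop
  -- The simple approximations of `f` involve only countably many level sets, so one null set of
  -- points `x` serves them all.
  have hae : ∀ᵐ x, ∀ k, ∀ c ∈ (SimpleFunc.eapprox (fun u => (f u : ℝ≥0∞)) k).range,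
      P x (SimpleFunc.eapprox (fun u => (f u : ℝ≥0∞)) k ⁻¹' {c}) =
        P' x (SimpleFunc.eapprox (fun u => (f u : ℝ≥0∞)) k ⁻¹' {c}) :=
    ae_all_iff.2 fun k => (Finset.eventually_all _).2 fun c _ =>
      h.ae_eq_apply h' (SimpleFunc.measurableSet_preimage _ _)
  have hae' : (fun x => ∫⁻ u, f u ∂P x) =ᵐ[volume] fun x => ∫⁻ u, f u ∂P' x := by
    filter_upwards [hae] with x hx
    rw [lintegral_eq_iSup_eapprox_lintegral hm, lintegral_eq_iSup_eapprox_lintegral hm]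
    refine iSup_congr fun k => Finset.sum_congr rfl fun c hc => ?_
    rw [hx k c hc]
  -- Both integrals of `f` are continuous in `x`, and Lebesgue measure charges every nonempty open
  -- set, so almost everywhere equality becomes equality.
  exact congrFun ((Continuous.ae_eq_iff_eq volume (h.continuous_lintegral f)
    (h'.continuous_lintegral f)).1 hae') x

lemma IsPhaseDensity.phaseDensity_eq (h : IsPhaseDensity M P) : phaseDensity M = P := by
  have hex : ∃ P, IsPhaseDensity M P := ⟨P, h⟩
  rw [phaseDensity, dif_pos hex]
  exact hex.choose_spec.unique h

end Uniqueness

/-! ### Isotropic Gaussian measures and their characteristic functions. -/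

section GaussianDensity

open scoped RealInnerProductSpace

variable {n : ℕ}

/-- The density of the centred Gaussian distribution on `ℝⁿ` with covariance `v` times the
identity. -/
noncomputable def gaussDensity (n : ℕ) (v : ℝ) (y : Vec n) : ℝ :=
  (Real.pi / (2 * v)⁻¹) ^ (-(n : ℝ) / 2) * Real.exp (-(2 * v)⁻¹ * ‖y‖ ^ 2)

lemma gaussDensity_pos {v : ℝ} (hv : 0 < v) (y : Vec n) : 0 < gaussDensity n v y := by
  unfold gaussDensity
  positivity

lemma continuous_gaussDensity (n : ℕ) (v : ℝ) : Continuous (gaussDensity n v) := by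
  unfold gaussDensity
  fun_prop

lemma integrable_exp_neg_mul_sq_norm {b : ℝ} (hb : 0 < b) :
    Integrable fun y : Vec n => Real.exp (-b * ‖y‖ ^ 2) := by
  have := (GaussianFourier.integrable_cexp_neg_mul_sq_norm_add (V := Vec n) (b := b)
    (by simpa using hb) 0 0).norm
  refine this.congr (Eventually.of_forall fun y => ?_)
  simp only [Complex.norm_exp]
  congr 1
  simp [← Complex.ofReal_pow]

/-- The centred Gaussian measure on `ℝⁿ` with covariance `v` times the identity. -/
noncomputable def gaussMeasure (n : ℕ) (v : ℝ) : Measure (Vec n) :=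
  volume.withDensity fun y => ENNReal.ofReal (gaussDensity n v y)

instance isFiniteMeasure_gaussMeasure (n : ℕ) (v : ℝ) [Fact (0 < v)] :
    IsFiniteMeasure (gaussMeasure n v) :=
  isFiniteMeasure_withDensity_ofReal
    ((integrable_exp_neg_mul_sq_norm (inv_pos.2 (mul_pos two_pos Fact.out))).const_mul _).2

/-- The Gaussian Fourier integral with `b = (2v)⁻¹` yields the factor `(π / b) ^ (n / 2)`, which the
constant in `gaussDensity`, written in the same form, cancels. -/
lemma charFun_gaussMeasure {v : ℝ} (hv : 0 < v) (p : Vec n) :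
    charFun (gaussMeasure n v) p = Complex.exp (-(v * ‖p‖ ^ 2 : ℝ) / 2) := by
  have hb : 0 < (2 * v)⁻¹ := by positivity
  rw [charFun_apply, gaussMeasure, integral_withDensity_eq_integral_toReal_smul
    (continuous_gaussDensity n v).measurable.ennreal_ofReal (by simp)]
  have h1 : ∀ y : Vec n, (ENNReal.ofReal (gaussDensity n v y)).toReal •
      Complex.exp (⟪y, p⟫ * Complex.I) = (((Real.pi / (2 * v)⁻¹) ^ (-(n : ℝ) / 2) : ℝ) : ℂ) *
        Complex.exp (-((2 * v)⁻¹ : ℝ) * ‖y‖ ^ 2 + Complex.I * ⟪p, y⟫) := fun y => by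
    rw [ENNReal.toReal_ofReal (gaussDensity_pos hv y).le, gaussDensity, Complex.real_smul,
      Complex.exp_add, real_inner_comm]
    push_cast
    ring_nf
  simp_rw [h1]
  rw [integral_const_mul, GaussianFourier.integral_cexp_neg_mul_sq_norm_add (by simpa using hb)]
  have h2 : ((Real.pi : ℂ) / ((2 * v)⁻¹ : ℝ)) ^ ((Module.finrank ℝ (Vec n) : ℂ) / 2) =
      (((Real.pi / (2 * v)⁻¹) ^ ((n : ℝ) / 2) : ℝ) : ℂ) := by
    rw [Complex.ofReal_cpow (by positivity)]
    simp
  rw [h2, ← mul_assoc, ← Complex.ofReal_mul, ← Real.rpow_add (by positivity)]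
  have h3 : -(n : ℝ) / 2 + n / 2 = 0 := by ring
  rw [h3, Real.rpow_zero, Complex.ofReal_one, one_mul]
  congr 1
  have hv' : (v : ℂ) ≠ 0 := by exact_mod_cast hv.ne'
  rw [Complex.I_sq]
  push_cast
  field_simp
  norm_num

end GaussianDensity

/-! ### Regression of the velocity noise on the position noise. -/

section NoiseLaw

open scoped RealInnerProductSpace

variable {n : ℕ} {Ω : Type*} [MeasurableSpace Ω] {μ : Measure Ω} {W₁ W₂ : Fin n → ℝ≥0 → Ω → ℝ}

/-- The variance of a coordinate of `X(t)` for given initial values. -/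
noncomputable def posVar (σ : ℝ × ℝ) (t : ℝ) : ℝ := σ.1 ^ 2 * t + σ.2 ^ 2 * (t ^ 3 / 3)

/-- The regression coefficient of `U(t)` on `X(t)`. -/
noncomputable def regCoeff (σ : ℝ × ℝ) (t : ℝ) : ℝ := σ.2 ^ 2 * (t ^ 2 / 2) / posVar σ t

/-- The standard deviation of the part of `U(t)` that is independent of `X(t)`. -/
noncomputable def resDev (σ : ℝ × ℝ) (t : ℝ) : ℝ :=
  √(σ.2 ^ 2 * t - regCoeff σ t ^ 2 * posVar σ t)

lemma posVar_pos {σ : ℝ × ℝ} (hσ : σ ≠ 0) {t : ℝ} (ht : 0 < t) : 0 < posVar σ t := by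
  unfold posVar
  by_cases h1 : σ.1 = 0
  · have h2 : σ.2 ≠ 0 := fun h2 => hσ (Prod.ext h1 h2)
    positivity
  · positivity

lemma regCoeff_nonneg {σ : ℝ × ℝ} (hσ : σ ≠ 0) {t : ℝ} (ht : 0 < t) : 0 ≤ regCoeff σ t := by
  have := posVar_pos hσ ht
  unfold regCoeff
  positivity

/-- Already the `σ₂` part of the variance, `σ₂² t³ / 3`, gives the bound. Its uniformity in `σ` is
what the final limit needs: `regCoeff σ t` depends on the ratio of `σ₁` and `σ₂` and has no limit as
`σ → 0`. -/
lemma regCoeff_le {σ : ℝ × ℝ} (hσ : σ ≠ 0) {t : ℝ} (ht : 0 < t) :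
    regCoeff σ t ≤ 3 / (2 * t) := by
  rw [regCoeff, div_le_div_iff₀ (posVar_pos hσ ht) (by positivity), posVar]
  nlinarith [mul_nonneg (sq_nonneg σ.1) ht.le]

lemma regCoeff_mul_posVar {σ : ℝ × ℝ} (hσ : σ ≠ 0) {t : ℝ} (ht : 0 < t) :
    regCoeff σ t * posVar σ t = σ.2 ^ 2 * (t ^ 2 / 2) :=
  div_mul_cancel₀ _ (posVar_pos hσ ht).ne'

/-- The square root in `resDev` must not be truncated at `0`: the explained variance `c² posVar` is
at most `3/4` of `σ₂² t`. -/
lemma sq_resDev {σ : ℝ × ℝ} (hσ : σ ≠ 0) {t : ℝ} (ht : 0 < t) :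
    resDev σ t ^ 2 = σ.2 ^ 2 * t - regCoeff σ t ^ 2 * posVar σ t := by
  refine Real.sq_sqrt ?_
  have h1 : regCoeff σ t ^ 2 * posVar σ t = regCoeff σ t * (σ.2 ^ 2 * (t ^ 2 / 2)) := by
    rw [← regCoeff_mul_posVar hσ ht]; ring
  have h2 : regCoeff σ t * (σ.2 ^ 2 * (t ^ 2 / 2)) ≤ 3 / (2 * t) * (σ.2 ^ 2 * (t ^ 2 / 2)) :=
    mul_le_mul_of_nonneg_right (regCoeff_le hσ ht) (by positivity)
  have h3 : 3 / (2 * t) * (σ.2 ^ 2 * (t ^ 2 / 2)) = σ.2 ^ 2 * t * (3 / 4) := by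
    field_simp; ring
  rw [h1]
  nlinarith [mul_nonneg (sq_nonneg σ.2) ht.le]

/-- The random part of `X(t)`. -/
noncomputable def posNoise (σ : ℝ × ℝ) (W₁ W₂ : Fin n → ℝ≥0 → Ω → ℝ) (t : ℝ) (ω : Ω) : Vec n :=
  WithLp.toLp 2 fun k =>
    σ.2 * (∫ τ in (0 : ℝ)..t, W₂ k τ.toNNReal ω) + σ.1 * W₁ k t.toNNReal ω

lemma aemeasurable_vec {W : Fin n → ℝ≥0 → Ω → ℝ} (hW : ∀ k, IsBrownianReal (W k) μ) (t : ℝ) :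
    AEMeasurable (vec W t) μ :=
  (PiLp.continuous_toLp 2 _).measurable.comp_aemeasurable
    (aemeasurable_pi_lambda _ fun k => (hW k).aemeasurable _)

lemma aemeasurable_posNoise (hW : IsBrownianPair W₁ W₂ μ) (σ : ℝ × ℝ) {t : ℝ} (ht : 0 ≤ t) :
    AEMeasurable (posNoise σ W₁ W₂ t) μ := by
  refine (PiLp.continuous_toLp 2 _).measurable.comp_aemeasurable
    (aemeasurable_pi_lambda _ fun k => ?_)
  have := aemeasurable_integral_brownian (hW.brownian₂ k) t.toNNReal
  rw [Real.coe_toNNReal _ ht] at this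
  exact (this.const_mul _).add (((hW.brownian₁ k).aemeasurable _).const_mul _)

/-- For almost every `ω`, `X(t)` is an affine function of the initial values. -/
lemma ae_position_eq (hW : IsBrownianPair W₁ W₂ μ) (σ : ℝ × ℝ) (t : ℝ) :
    ∀ᵐ ω ∂μ, ∀ x u : Vec n, position σ W₁ W₂ x u t ω = x + t • u + posNoise σ W₁ W₂ t ω := by
  have hcont : ∀ᵐ ω ∂μ, ∀ k, Continuous (W₂ k · ω) := ae_all_iff.2 fun k => (hW.brownian₂ k).cont
  filter_upwards [hcont] with ω hω x u
  have hv : Continuous fun τ => vec W₂ τ ω := by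
    refine (PiLp.continuous_toLp 2 _).comp (continuous_pi fun k => ?_)
    exact (hω k).comp continuous_real_toNNReal
  have h1 : ∫ τ in (0 : ℝ)..t, velocity σ W₂ u τ ω =
      t • u + σ.2 • ∫ τ in (0 : ℝ)..t, vec W₂ τ ω := by
    have hi : IntervalIntegrable (fun τ => σ.2 • vec W₂ τ ω) volume 0 t :=
      (hv.const_smul σ.2).intervalIntegrable _ _
    unfold velocity
    rw [intervalIntegral.integral_add intervalIntegrable_const hi,
      intervalIntegral.integral_const, intervalIntegral.integral_smul, sub_zero]
  rw [position, h1]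
  ext k
  have h2 : (∫ τ in (0 : ℝ)..t, vec W₂ τ ω) k = ∫ τ in (0 : ℝ)..t, W₂ k τ.toNNReal ω :=
    (ContinuousLinearMap.intervalIntegral_comp_comm (EuclideanSpace.proj k : Vec n →L[ℝ] ℝ)
      (hv.intervalIntegrable 0 t)).symm
  simp only [PiLp.add_apply, PiLp.smul_apply, smul_eq_mul, h2, posNoise]
  simp only [vec]
  ring

/-- The joint distribution of the noise in position and velocity. -/
theorem map_noise [IsProbabilityMeasure μ] (hW : IsBrownianPair W₁ W₂ μ) {σ : ℝ × ℝ} (hσ : σ ≠ 0)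
    {t : ℝ} (ht : 0 < t) :
    μ.map (fun ω => (posNoise σ W₁ W₂ t ω, σ.2 • vec W₂ t ω)) =
      ((gaussMeasure n (posVar σ t)).prod (stdGaussian (Vec n))).map
        fun q => (q.1, regCoeff σ t • q.1 + resDev σ t • q.2) := by
  have hv := posVar_pos hσ ht
  have : Fact (0 < posVar σ t) := ⟨hv⟩
  have hm : AEMeasurable (fun ω => (posNoise σ W₁ W₂ t ω, σ.2 • vec W₂ t ω)) μ :=
    (aemeasurable_posNoise hW σ ht.le).prodMk
      (AEMeasurable.const_smul (g := vec W₂ t) (aemeasurable_vec hW.brownian₂ t) σ.2)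
  -- The product space carries the sup norm and no inner product, so characteristic functions are
  -- taken on the dual; `p` and `q` represent the two components of `L`.
  refine Measure.ext_of_charFunDual (funext fun L => ?_)
  set p : Vec n := (InnerProductSpace.toDual ℝ (Vec n)).symm
    (L.comp (ContinuousLinearMap.inl ℝ (Vec n) (Vec n)))
  set q : Vec n := (InnerProductSpace.toDual ℝ (Vec n)).symm
    (L.comp (ContinuousLinearMap.inr ℝ (Vec n) (Vec n)))
  have hL : ∀ y z : Vec n, L (y, z) = ⟪y, p⟫ + ⟪z, q⟫ := fun y z => by
    rw [real_inner_comm, real_inner_comm q, InnerProductSpace.toDual_symm_apply,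
      InnerProductSpace.toDual_symm_apply]
    simp [← map_add]
  rw [charFunDual_apply, charFunDual_apply, integral_map hm (by fun_prop),
    integral_map (by fun_prop) (by fun_prop)]
  have hRHS : ∫ r, Complex.exp (L (r.1, regCoeff σ t • r.1 + resDev σ t • r.2) * Complex.I)
      ∂((gaussMeasure n (posVar σ t)).prod (stdGaussian (Vec n))) =
      charFun (gaussMeasure n (posVar σ t)) (p + regCoeff σ t • q) *
        charFun (stdGaussian (Vec n)) (resDev σ t • q) := by
    rw [charFun_apply, charFun_apply, ← integral_prod_mul]
    refine integral_congr_ae (Eventually.of_forall fun r => ?_)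
    simp only [← Complex.exp_add, hL]
    congr 1
    rw [inner_add_left, inner_add_right, real_inner_smul_left, real_inner_smul_left,
      real_inner_smul_right, real_inner_smul_right]
    push_cast
    ring
  rw [hRHS, charFun_gaussMeasure hv, charFun_stdGaussian]
  let W : Fin n ⊕ Fin n → ℝ≥0 → Ω → ℝ := fun i s ω =>
    Sum.elim (fun k => W₁ k s ω) (fun k => W₂ k s ω) i
  have hWB : ∀ i, IsBrownianReal (W i) μ := by
    rintro (k | k)
    · exact hW.brownian₁ k
    · exact hW.brownian₂ k
  have hmain := integral_cexp_brownian hWB hW.indep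
    (Sum.elim (fun _ => 0) fun k => σ.2 * p k)
    (Sum.elim (fun k => σ.1 * p k) fun k => σ.2 * q k) t.toNNReal
  rw [Real.coe_toNNReal _ ht.le] at hmain
  have hLHS : ∀ ω, L (posNoise σ W₁ W₂ t ω, σ.2 • vec W₂ t ω) = ∑ i : Fin n ⊕ Fin n,
      (Sum.elim (fun _ => 0) (fun k => σ.2 * p k) i * (∫ τ in (0 : ℝ)..t, W i τ.toNNReal ω) +
        Sum.elim (fun k => σ.1 * p k) (fun k => σ.2 * q k) i * W i t.toNNReal ω) := fun ω => by
    rw [hL, Fintype.sum_sum_type, ← Finset.sum_add_distrib, PiLp.inner_apply, PiLp.inner_apply,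
      ← Finset.sum_add_distrib]
    refine Finset.sum_congr rfl fun k _ => ?_
    simp only [posNoise, vec, W, Sum.elim_inl, Sum.elim_inr, RCLike.inner_apply, conj_trivial,
      PiLp.smul_apply, smul_eq_mul]
    ring
  simp_rw [hLHS]
  rw [hmain, ← Complex.exp_add]
  congr 1
  -- Completing the square: coordinatewise `σ₁² t p² + σ₂² (t³/3 p² + t² p q + t q²)` equals `posVar
  -- (p + c q)² + b² q²`.
  have hvar : ∑ i : Fin n ⊕ Fin n, brownianVariance
      (Sum.elim (fun _ => 0) (fun k => σ.2 * p k) i)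
      (Sum.elim (fun k => σ.1 * p k) (fun k => σ.2 * q k) i) t =
      posVar σ t * ‖p + regCoeff σ t • q‖ ^ 2 + ‖resDev σ t • q‖ ^ 2 := by
    rw [Fintype.sum_sum_type, ← Finset.sum_add_distrib, EuclideanSpace.real_norm_sq_eq,
      EuclideanSpace.real_norm_sq_eq, Finset.mul_sum, ← Finset.sum_add_distrib]
    refine Finset.sum_congr rfl fun k _ => ?_
    simp only [Sum.elim_inl, Sum.elim_inr, brownianVariance, PiLp.add_apply, PiLp.smul_apply,
      smul_eq_mul, mul_pow, sq_resDev hσ ht]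
    have hreg := regCoeff_mul_posVar hσ ht
    have hpos : posVar σ t = σ.1 ^ 2 * t + σ.2 ^ 2 * (t ^ 3 / 3) := rfl
    linear_combination (-(p k) ^ 2) * hpos - 2 * p k * q k * hreg
  rw [hvar]
  push_cast
  ring

end NoiseLaw

/-! ### The explicit phase density. -/

section ExplicitDensity

variable {n : ℕ}

/-- The position at time `t` of a particle that starts at `s` with velocity `u₀(s)`. -/
def flow (u₀ : Vec n → Vec n) (t : ℝ) (s : Vec n) : Vec n := s + t • u₀ s

lemma continuous_flow {u₀ : Vec n → Vec n} (hu₀ : Continuous u₀) (t : ℝ) :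
    Continuous (flow u₀ t) := continuous_id.add (hu₀.const_smul t)

lemma norm_le_norm_sub_flow_add {u₀ : Vec n → Vec n} {C : ℝ} (hC : ∀ x, ‖u₀ x‖ ≤ C) {t : ℝ}
    (ht : 0 ≤ t) (x s : Vec n) : ‖s‖ ≤ ‖x - flow u₀ t s‖ + (‖x‖ + t * C) := by
  have h1 : s = x - t • u₀ s - (x - flow u₀ t s) := by
    simp only [flow]; abel
  have h2 : ‖t • u₀ s‖ ≤ t * C := by
    rw [norm_smul, Real.norm_of_nonneg ht]
    exact mul_le_mul_of_nonneg_left (hC s) ht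
  calc ‖s‖ = ‖x - t • u₀ s - (x - flow u₀ t s)‖ := congrArg _ h1
    _ ≤ ‖x‖ + ‖t • u₀ s‖ + ‖x - flow u₀ t s‖ :=
      (norm_sub_le _ _).trans (add_le_add_left (norm_sub_le _ _) _)
    _ ≤ _ := by linarith

/-- A locally uniform integrable bound for the Gaussian weights. -/
lemma exp_neg_sq_norm_sub_flow_le {u₀ : Vec n → Vec n} {C : ℝ} (hC : ∀ x, ‖u₀ x‖ ≤ C) {t : ℝ}
    (ht : 0 ≤ t) {b : ℝ} (hb : 0 < b) {R : ℝ} {x : Vec n} (hx : ‖x‖ ≤ R) (s : Vec n) :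
    Real.exp (-b * ‖x - flow u₀ t s‖ ^ 2) ≤
      Real.exp (b * (R + t * C) ^ 2) * Real.exp (-(b / 2) * ‖s‖ ^ 2) := by
  rw [← Real.exp_add, Real.exp_le_exp]
  have h1 := norm_le_norm_sub_flow_add hC ht x s
  set y := ‖x - flow u₀ t s‖
  have h2 : ‖s‖ ≤ y + (R + t * C) := by linarith
  have h3 : ‖s‖ ^ 2 ≤ 2 * y ^ 2 + 2 * (R + t * C) ^ 2 := by
    have := pow_le_pow_left₀ (norm_nonneg s) h2 2
    nlinarith [sq_nonneg (y - (R + t * C))]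
  nlinarith

variable {u₀ : Vec n → Vec n} {ρ₀ : Vec n → ℝ}

lemma integrable_weight (hu₀ : Continuous u₀) {C : ℝ} (hC : ∀ x, ‖u₀ x‖ ≤ C)
    (hρ₀ : Continuous ρ₀) {D : ℝ} (hD : ∀ x, ρ₀ x ≤ D) (hpos : ∀ x, 0 < ρ₀ x) {t : ℝ} (ht : 0 ≤ t)
    {b : ℝ} (hb : 0 < b) (x : Vec n) :
    Integrable fun s => ρ₀ s * Real.exp (-b * ‖x - flow u₀ t s‖ ^ 2) := by
  have hf := continuous_flow hu₀ t
  refine Integrable.mono' (((integrable_exp_neg_mul_sq_norm (n := n) (half_pos hb)).const_mul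
    (Real.exp (b * (‖x‖ + t * C) ^ 2))).const_mul D)
    (by fun_prop : Continuous _).aestronglyMeasurable (Eventually.of_forall fun s => ?_)
  rw [Real.norm_of_nonneg (mul_nonneg (hpos s).le (Real.exp_pos _).le)]
  exact mul_le_mul (hD s) (exp_neg_sq_norm_sub_flow_le hC ht hb le_rfl s) (Real.exp_pos _).le
    ((hpos s).le.trans (hD s))

/-- Half of the Gaussian exponent absorbs the linear factor, by `y ≤ (1 + 2/b) exp(b y² / 2)`. -/
lemma integrable_weight_mul_norm (hu₀ : Continuous u₀) {C : ℝ} (hC : ∀ x, ‖u₀ x‖ ≤ C)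
    (hρ₀ : Continuous ρ₀) {D : ℝ} (hD : ∀ x, ρ₀ x ≤ D) (hpos : ∀ x, 0 < ρ₀ x) {t : ℝ} (ht : 0 ≤ t)
    {b : ℝ} (hb : 0 < b) (x : Vec n) :
    Integrable fun s =>
      ρ₀ s * Real.exp (-b * ‖x - flow u₀ t s‖ ^ 2) * ‖x - flow u₀ t s‖ := by
  have hf := continuous_flow hu₀ t
  refine Integrable.mono' ((integrable_weight hu₀ hC hρ₀ hD hpos ht (half_pos hb) x).const_mul
    (1 + 2 / b)) (by fun_prop : Continuous _).aestronglyMeasurable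
    (Eventually.of_forall fun s => ?_)
  set y := ‖x - flow u₀ t s‖
  have hy : 0 ≤ y := norm_nonneg _
  rw [Real.norm_of_nonneg (mul_nonneg (mul_nonneg (hpos s).le (Real.exp_pos _).le) hy)]
  have h1 : y ≤ (1 + 2 / b) * Real.exp (b / 2 * y ^ 2) := by
    have h2 : (1 + 2 / b) * (1 + b / 2 * y ^ 2) = 1 + b / 2 * y ^ 2 + 2 / b + y ^ 2 := by
      field_simp
      ring
    have h3 := mul_le_mul_of_nonneg_left (Real.add_one_le_exp (b / 2 * y ^ 2))
      (by positivity : (0 : ℝ) ≤ 1 + 2 / b)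
    have h4 : (0 : ℝ) ≤ b / 2 * y ^ 2 := by positivity
    have h5 : (0 : ℝ) ≤ 2 / b := by positivity
    nlinarith [sq_nonneg (y - 1)]
  have h6 : Real.exp (-b * y ^ 2) * Real.exp (b / 2 * y ^ 2) = Real.exp (-(b / 2) * y ^ 2) := by
    rw [← Real.exp_add]
    congr 1
    ring
  calc ρ₀ s * Real.exp (-b * y ^ 2) * y
      ≤ ρ₀ s * Real.exp (-b * y ^ 2) * ((1 + 2 / b) * Real.exp (b / 2 * y ^ 2)) :=
        mul_le_mul_of_nonneg_left h1 (mul_nonneg (hpos s).le (Real.exp_pos _).le)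
    _ = (1 + 2 / b) * (ρ₀ s * (Real.exp (-b * y ^ 2) * Real.exp (b / 2 * y ^ 2))) := by ring
    _ = _ := by rw [h6]

/-- The distribution of the starting point of the particles that arrive at `x` at time `t`,
not normalized; `v` is the variance of the noise in position. -/
noncomputable def startMeasure (u₀ : Vec n → Vec n) (ρ₀ : Vec n → ℝ) (v t : ℝ) (x : Vec n) :
    Measure (Vec n) :=
  volume.withDensity fun s => ENNReal.ofReal (ρ₀ s * gaussDensity n v (x - flow u₀ t s))

/-- The phase density in terms of the starting point: `c` is the regression coefficient of
the velocity on the position and `b` the standard deviation of the rest of the velocity. -/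
noncomputable def explicitDensity (u₀ : Vec n → Vec n) (ρ₀ : Vec n → ℝ) (v c b t : ℝ)
    (x : Vec n) : Measure (Vec n) :=
  ((startMeasure u₀ ρ₀ v t x).prod (stdGaussian (Vec n))).map
    fun q => u₀ q.1 + c • (x - flow u₀ t q.1) + b • q.2

lemma integrable_gaussWeight (hu₀ : Continuous u₀) {C : ℝ} (hC : ∀ x, ‖u₀ x‖ ≤ C)
    (hρ₀ : Continuous ρ₀) {D : ℝ} (hD : ∀ x, ρ₀ x ≤ D) (hpos : ∀ x, 0 < ρ₀ x) {t : ℝ} (ht : 0 ≤ t)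
    {v : ℝ} (hv : 0 < v) (x : Vec n) :
    Integrable fun s => ρ₀ s * gaussDensity n v (x - flow u₀ t s) := by
  have := (integrable_weight hu₀ hC hρ₀ hD hpos ht (b := (2 * v)⁻¹) (by positivity) x).const_mul
    ((Real.pi / (2 * v)⁻¹) ^ (-(n : ℝ) / 2))
  refine this.congr (Eventually.of_forall fun s => ?_)
  simp only [gaussDensity]
  ring

lemma isFiniteMeasure_startMeasure (hu₀ : Continuous u₀) {C : ℝ} (hC : ∀ x, ‖u₀ x‖ ≤ C)
    (hρ₀ : Continuous ρ₀) {D : ℝ} (hD : ∀ x, ρ₀ x ≤ D) (hpos : ∀ x, 0 < ρ₀ x) {t : ℝ} (ht : 0 ≤ t)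
    {v : ℝ} (hv : 0 < v) (x : Vec n) : IsFiniteMeasure (startMeasure u₀ ρ₀ v t x) :=
  isFiniteMeasure_withDensity_ofReal
    (integrable_gaussWeight hu₀ hC hρ₀ hD hpos ht hv x).2

lemma measurable_gaussWeight (hu₀ : Continuous u₀) (hρ₀ : Continuous ρ₀) (v t : ℝ) :
    Measurable fun q : Vec n × Vec n =>
      ENNReal.ofReal (ρ₀ q.2 * gaussDensity n v (q.1 - flow u₀ t q.2)) := by
  have hf := continuous_flow hu₀ t
  have hg := continuous_gaussDensity n v
  exact (by fun_prop : Continuous fun q : Vec n × Vec n =>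
    ρ₀ q.2 * gaussDensity n v (q.1 - flow u₀ t q.2)).measurable.ennreal_ofReal

lemma measurable_gaussWeight_right (hu₀ : Continuous u₀) (hρ₀ : Continuous ρ₀) (v t : ℝ)
    (x : Vec n) :
    Measurable fun s => ENNReal.ofReal (ρ₀ s * gaussDensity n v (x - flow u₀ t s)) :=
  (measurable_gaussWeight hu₀ hρ₀ v t).comp measurable_prodMk_left

lemma integral_startMeasure {E : Type*} [NormedAddCommGroup E] [NormedSpace ℝ E]
    (hu₀ : Continuous u₀) (hρ₀ : Continuous ρ₀) (hpos : ∀ x, 0 < ρ₀ x) {v : ℝ} (hv : 0 < v)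
    (t : ℝ) (x : Vec n) (f : Vec n → E) :
    ∫ s, f s ∂startMeasure u₀ ρ₀ v t x =
      ∫ s, (ρ₀ s * gaussDensity n v (x - flow u₀ t s)) • f s := by
  rw [startMeasure, integral_withDensity_eq_integral_toReal_smul
    (measurable_gaussWeight_right hu₀ hρ₀ v t x) (by simp)]
  refine integral_congr_ae (Eventually.of_forall fun s => ?_)
  dsimp only
  rw [ENNReal.toReal_ofReal (mul_nonneg (hpos s).le (gaussDensity_pos hv _).le)]

lemma continuous_arrival (hu₀ : Continuous u₀) (c b t : ℝ) (x : Vec n) :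
    Continuous fun q : Vec n × Vec n => u₀ q.1 + c • (x - flow u₀ t q.1) + b • q.2 := by
  have hf := continuous_flow hu₀ t
  fun_prop

/-- Dominated convergence. The Gaussian bound in the starting point is uniform only for bounded `x`,
so continuity is checked at each `x₀` using the unit ball around it. -/
lemma continuous_integral_explicitDensity (hu₀ : Continuous u₀) {C : ℝ} (hC : ∀ x, ‖u₀ x‖ ≤ C)
    (hρ₀ : Continuous ρ₀) {D : ℝ} (hD : ∀ x, ρ₀ x ≤ D) (hpos : ∀ x, 0 < ρ₀ x) {t : ℝ} (ht : 0 ≤ t)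
    {v : ℝ} (hv : 0 < v) (c b : ℝ) (f : Vec n →ᵇ ℝ) :
    Continuous fun x => ∫ u, f u ∂explicitDensity u₀ ρ₀ v c b t x := by
  have hf := continuous_flow hu₀ t
  have hg := continuous_gaussDensity n v
  have hw : ∀ x s : Vec n, 0 < ρ₀ s * gaussDensity n v (x - flow u₀ t s) := fun x s =>
    mul_pos (hpos s) (gaussDensity_pos hv _)
  have heq : ∀ x, ∫ u, f u ∂explicitDensity u₀ ρ₀ v c b t x =
      ∫ q : Vec n × Vec n, (ρ₀ q.1 * gaussDensity n v (x - flow u₀ t q.1)) *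
        f (u₀ q.1 + c • (x - flow u₀ t q.1) + b • q.2)
        ∂((volume : Measure (Vec n)).prod (stdGaussian (Vec n))) := by
    intro x
    have hmw := measurable_gaussWeight_right hu₀ hρ₀ v t x
    have hmw' : Measurable fun q : Vec n × Vec n =>
        ENNReal.ofReal (ρ₀ q.1 * gaussDensity n v (x - flow u₀ t q.1)) := hmw.comp measurable_fst
    rw [explicitDensity, integral_map (continuous_arrival hu₀ c b t x).measurable.aemeasurable
      f.continuous.aestronglyMeasurable, startMeasure, prod_withDensity_left hmw,
      integral_withDensity_eq_integral_toReal_smul hmw' (by simp)]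
    refine integral_congr_ae (Eventually.of_forall fun q => ?_)
    simp only [smul_eq_mul]
    rw [ENNReal.toReal_ofReal (hw x q.1).le]
  simp_rw [heq]
  refine continuous_iff_continuousAt.2 fun x₀ => ?_
  have hb : 0 < (2 * v)⁻¹ := by positivity
  set k : ℝ := (Real.pi / (2 * v)⁻¹) ^ (-(n : ℝ) / 2) with hk
  have hk0 : 0 ≤ k := by positivity
  have hint := ((integrable_exp_neg_mul_sq_norm (n := n) (half_pos hb)).const_mul
    (D * (k * Real.exp ((2 * v)⁻¹ * (‖x₀‖ + 1 + t * C) ^ 2)) * ‖f‖)).comp_fst (stdGaussian (Vec n))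
  refine continuousAt_of_dominated (Eventually.of_forall fun x => ?_) ?_ hint
    (Eventually.of_forall fun q => ?_)
  · exact (by fun_prop : Continuous _).aestronglyMeasurable
  · filter_upwards [Metric.ball_mem_nhds x₀ one_pos] with x hx
    have hxR : ‖x‖ ≤ ‖x₀‖ + 1 := by
      have h1 := norm_sub_norm_le x x₀
      rw [Metric.mem_ball, dist_eq_norm] at hx
      linarith
    refine Eventually.of_forall fun q => ?_
    rw [norm_mul, Real.norm_of_nonneg (hw x q.1).le]
    have h1 := exp_neg_sq_norm_sub_flow_le hC ht hb hxR q.1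
    have h2 : gaussDensity n v (x - flow u₀ t q.1) ≤
        k * (Real.exp ((2 * v)⁻¹ * (‖x₀‖ + 1 + t * C) ^ 2) *
          Real.exp (-((2 * v)⁻¹ / 2) * ‖q.1‖ ^ 2)) := mul_le_mul_of_nonneg_left h1 hk0
    have hD0 : 0 ≤ D := (hpos q.1).le.trans (hD q.1)
    refine (mul_le_mul (mul_le_mul (hD q.1) h2 (gaussDensity_pos hv _).le hD0)
      (f.norm_coe_le_norm _) (norm_nonneg _) (by positivity)).trans (le_of_eq ?_)
    ring
  · exact (by fun_prop : Continuous _).continuousAt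

lemma explicitDensity_apply (hu₀ : Continuous u₀) (hρ₀ : Continuous ρ₀) (v c b t : ℝ)
    (x : Vec n) {B : Set (Vec n)} (hB : MeasurableSet B) :
    explicitDensity u₀ ρ₀ v c b t x B =
      ∫⁻ s, ENNReal.ofReal (ρ₀ s * gaussDensity n v (x - flow u₀ t s)) *
        stdGaussian (Vec n) {z | u₀ s + c • (x - flow u₀ t s) + b • z ∈ B} := by
  have hm := (continuous_arrival hu₀ c b t x).measurable
  have hmw := measurable_gaussWeight_right hu₀ hρ₀ v t x
  rw [explicitDensity, Measure.map_apply hm hB, Measure.prod_apply (hm hB), startMeasure,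
    lintegral_withDensity_eq_lintegral_mul _ hmw (measurable_measure_prodMk_left (hm hB))]
  rfl

/-- The joint law as the image of independent starting point, position noise and
residual velocity noise. -/
lemma jointLaw_eq_map (hu₀ : Continuous u₀) {Ω : Type*} [MeasurableSpace Ω] {μ : Measure Ω}
    [IsProbabilityMeasure μ] {W₁ W₂ : Fin n → ℝ≥0 → Ω → ℝ} (hW : IsBrownianPair W₁ W₂ μ)
    (ρ₀ : Vec n → ℝ) {σ : ℝ × ℝ} (hσ : σ ≠ 0) {t : ℝ} (ht : 0 < t) :
    jointLaw u₀ ρ₀ W₁ W₂ μ σ t =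
      (((volume : Measure (Vec n)).withDensity fun s => ENNReal.ofReal (ρ₀ s)).prod
        ((gaussMeasure n (posVar σ t)).prod (stdGaussian (Vec n)))).map
      fun q => (flow u₀ t q.1 + q.2.1,
        u₀ q.1 + (regCoeff σ t • q.2.1 + resDev σ t • q.2.2)) := by
  have : Fact (0 < posVar σ t) := ⟨posVar_pos hσ ht⟩
  have hf := continuous_flow hu₀ t
  have hm : AEMeasurable (fun ω => (posNoise σ W₁ W₂ t ω, σ.2 • vec W₂ t ω)) μ :=
    (aemeasurable_posNoise hW σ ht.le).prodMk
      (AEMeasurable.const_smul (g := vec W₂ t) (aemeasurable_vec hW.brownian₂ t) σ.2)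
  set m := (volume : Measure (Vec n)).withDensity fun s => ENNReal.ofReal (ρ₀ s)
  -- The noise is only almost everywhere measurable; a measurable version allows the image measures
  -- to be composed.
  let N := hm.mk _
  have hN : Measurable N := hm.measurable_mk
  let F : Vec n × Vec n × Vec n → Vec n × Vec n := fun q => (flow u₀ t q.1 + q.2.1, u₀ q.1 + q.2.2)
  have hF : Measurable F := (by fun_prop : Continuous F).measurable
  have h1 : (fun q : Vec n × Ω => (position σ W₁ W₂ q.1 (u₀ q.1) t q.2,
      velocity σ W₂ (u₀ q.1) t q.2)) =ᵐ[m.prod μ] F ∘ Prod.map id N := by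
    have h2 := (Measure.quasiMeasurePreserving_snd (μ := m) (ν := μ)).ae
      ((ae_position_eq hW σ t).and hm.ae_eq_mk)
    filter_upwards [h2] with q hq
    simp only [Function.comp_apply, Prod.map, id, F, N, ← hq.2, hq.1, velocity, flow]
  have hψ : Measurable fun q : Vec n × Vec n => (q.1, regCoeff σ t • q.1 + resDev σ t • q.2) := by
    fun_prop
  have h3 : μ.map N = ((gaussMeasure n (posVar σ t)).prod (stdGaussian (Vec n))).map
      fun q => (q.1, regCoeff σ t • q.1 + resDev σ t • q.2) := by
    rw [← map_noise hW hσ ht]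
    exact Measure.map_congr hm.ae_eq_mk.symm
  rw [jointLaw, Measure.map_congr h1, ← Measure.map_map hF (measurable_id.prodMap hN),
    ← Measure.map_prod_map m μ measurable_id hN, h3,
    Measure.map_prod_map m _ measurable_id hψ, Measure.map_map hF (measurable_id.prodMap hψ)]
  rfl

/-- For a fixed starting point `s`, translating the position noise by `flow u₀ t s` turns it into
the arrival point `x` (this is `hslice`). Tonelli then exchanges the integrals over `s` and `x`. -/
theorem isPhaseDensity_explicitDensity (hu₀ : Continuous u₀) {C : ℝ} (hC : ∀ x, ‖u₀ x‖ ≤ C)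
    (hρ₀ : Continuous ρ₀) {D : ℝ} (hD : ∀ x, ρ₀ x ≤ D) (hpos : ∀ x, 0 < ρ₀ x)
    {Ω : Type*} [MeasurableSpace Ω] {μ : Measure Ω} [IsProbabilityMeasure μ]
    {W₁ W₂ : Fin n → ℝ≥0 → Ω → ℝ} (hW : IsBrownianPair W₁ W₂ μ) {σ : ℝ × ℝ} (hσ : σ ≠ 0)
    {t : ℝ} (ht : 0 < t) :
    IsPhaseDensity (jointLaw u₀ ρ₀ W₁ W₂ μ σ t)
      (explicitDensity u₀ ρ₀ (posVar σ t) (regCoeff σ t) (resDev σ t) t) where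
  finite x := by
    have := isFiniteMeasure_startMeasure hu₀ hC hρ₀ hD hpos ht.le (posVar_pos hσ ht) x
    unfold explicitDensity
    infer_instance
  continuous f := continuous_integral_explicitDensity hu₀ hC hρ₀ hD hpos ht.le
    (posVar_pos hσ ht) _ _ f
  disintegration A B hA hB := by
    have hv := posVar_pos hσ ht
    have : Fact (0 < posVar σ t) := ⟨hv⟩
    set v := posVar σ t
    set c := regCoeff σ t
    set b := resDev σ t
    have hf := continuous_flow hu₀ t
    have hg := continuous_gaussDensity n v
    have hmF : Measurable fun q : Vec n × Vec n × Vec n => (flow u₀ t q.1 + q.2.1,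
        u₀ q.1 + (c • q.2.1 + b • q.2.2)) := (by fun_prop : Continuous _).measurable
    let K : Vec n → Vec n → ℝ≥0∞ := fun x s =>
      ENNReal.ofReal (ρ₀ s * gaussDensity n v (x - flow u₀ t s)) *
        stdGaussian (Vec n) {z | u₀ s + c • (x - flow u₀ t s) + b • z ∈ B}
    have hK : Measurable (Function.uncurry K) := by
      refine (measurable_gaussWeight hu₀ hρ₀ v t).mul ?_
      have hset : MeasurableSet {r : (Vec n × Vec n) × Vec n |
          u₀ r.1.2 + c • (r.1.1 - flow u₀ t r.1.2) + b • r.2 ∈ B} :=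
        (by fun_prop : Continuous fun r : (Vec n × Vec n) × Vec n =>
          u₀ r.1.2 + c • (r.1.1 - flow u₀ t r.1.2) + b • r.2).measurable hB
      exact measurable_measure_prodMk_left hset
    have hS := hmF (hA.prod hB)
    have hslice : ∀ s, (gaussMeasure n v).prod (stdGaussian (Vec n)) (Prod.mk s ⁻¹'
        ((fun q : Vec n × Vec n × Vec n => (flow u₀ t q.1 + q.2.1,
          u₀ q.1 + (c • q.2.1 + b • q.2.2))) ⁻¹' A ×ˢ B)) =
        ∫⁻ x in A, ENNReal.ofReal (gaussDensity n v (x - flow u₀ t s)) *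
          stdGaussian (Vec n) {z | u₀ s + c • (x - flow u₀ t s) + b • z ∈ B} := by
      intro s
      rw [Measure.prod_apply (measurable_prodMk_left hS), gaussMeasure,
        lintegral_withDensity_eq_lintegral_mul _ hg.measurable.ennreal_ofReal
          (measurable_measure_prodMk_left (measurable_prodMk_left hS)),
        ← lintegral_sub_right_eq_self _ (flow u₀ t s), ← lintegral_indicator hA]
      refine lintegral_congr fun x => ?_
      by_cases hx : x ∈ A
      · simp only [Set.indicator_of_mem hx, Pi.mul_apply]
        congr 2
        ext z
        simp [hx, add_assoc]
      · simp only [Set.indicator_of_notMem hx, Pi.mul_apply]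
        convert mul_zero _
        convert measure_empty (μ := stdGaussian (Vec n))
        ext z
        simp [hx]
    rw [jointLaw_eq_map hu₀ hW ρ₀ hσ ht, Measure.map_apply hmF (hA.prod hB),
      Measure.prod_apply hS, lintegral_withDensity_eq_lintegral_mul _
        hρ₀.measurable.ennreal_ofReal (measurable_measure_prodMk_left hS)]
    simp only [explicitDensity_apply hu₀ hρ₀ v c b t _ hB]
    rw [lintegral_lintegral_swap hK.aemeasurable]
    refine lintegral_congr fun s => ?_
    rw [Pi.mul_apply, hslice s, ← lintegral_const_mul' _ _ ENNReal.ofReal_ne_top]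
    refine lintegral_congr fun x => ?_
    simp only [K]
    rw [ENNReal.ofReal_mul (hpos s).le, mul_assoc]

lemma integrable_norm_startMeasure (hu₀ : Continuous u₀) {C : ℝ} (hC : ∀ x, ‖u₀ x‖ ≤ C)
    (hρ₀ : Continuous ρ₀) {D : ℝ} (hD : ∀ x, ρ₀ x ≤ D) (hpos : ∀ x, 0 < ρ₀ x) {t : ℝ} (ht : 0 ≤ t)
    {v : ℝ} (hv : 0 < v) (x : Vec n) :
    Integrable (fun s => ‖x - flow u₀ t s‖) (startMeasure u₀ ρ₀ v t x) := by
  rw [startMeasure, integrable_withDensity_iff_integrable_smul'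
    (measurable_gaussWeight_right hu₀ hρ₀ v t x) (by simp)]
  refine ((integrable_weight_mul_norm hu₀ hC hρ₀ hD hpos ht (b := (2 * v)⁻¹) (by positivity)
    x).const_mul ((Real.pi / (2 * v)⁻¹) ^ (-(n : ℝ) / 2))).congr (Eventually.of_forall fun s => ?_)
  simp only [smul_eq_mul]
  rw [ENNReal.toReal_ofReal (mul_nonneg (hpos s).le (gaussDensity_pos hv _).le), gaussDensity]
  ring

end ExplicitDensity

/-! ### Laplace's method for ratios of integrals. -/

section Laplace

variable {n : ℕ}

/-- Laplace's method: the weights `ρ exp(-M h)` concentrate at the strict minimum of `h`. -/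
theorem tendsto_laplace_ratio {h ρ G : Vec n → ℝ} {s₀ : Vec n} (hh : Continuous h)
    (h0 : h s₀ = 0) (hmin : ∀ V ∈ 𝓝 s₀, ∃ δ > 0, ∀ s ∉ V, δ ≤ h s)
    (hpos : ∀ s, 0 < ρ s) (hG : Continuous G)
    (hGnn : ∀ s, 0 ≤ G s) (hG0 : G s₀ = 0)
    (hi : ∀ M : ℝ, 0 < M → Integrable fun s => ρ s * Real.exp (-M * h s))
    (hiG : ∀ M : ℝ, 0 < M → Integrable fun s => ρ s * Real.exp (-M * h s) * G s) :
    Tendsto (fun M : ℝ => (∫ s, ρ s * Real.exp (-M * h s) * G s) /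
      ∫ s, ρ s * Real.exp (-M * h s)) atTop (𝓝 0) := by
  have hwpos : ∀ (M : ℝ) s, 0 < ρ s * Real.exp (-M * h s) := fun M s =>
    mul_pos (hpos s) (Real.exp_pos _)
  rw [Metric.tendsto_nhds]
  intro ε hε
  have hV : {s | G s < ε / 2} ∈ 𝓝 s₀ :=
    (isOpen_lt hG continuous_const).mem_nhds (by simpa [hG0] using half_pos hε)
  obtain ⟨δ, hδ, hδV⟩ := hmin _ hV
  -- The gap between `δ / 2` here and `δ` outside the neighbourhood of `s₀` makes the tail
  -- negligible. The weights at `M = 1` serve as reference; no second-order expansion of `h` is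
  -- needed.
  set V' : Set (Vec n) := {s | h s < δ / 2} with hV'
  have hV'o : IsOpen V' := isOpen_lt hh continuous_const
  set κ := ∫ s in V', ρ s * Real.exp (-1 * h s) with hκ
  have hκpos : 0 < κ := by
    rw [hκ, setIntegral_pos_iff_support_of_nonneg_ae
      (Eventually.of_forall fun s => (hwpos 1 s).le) (hi 1 one_pos).integrableOn]
    have : Function.support (fun s => ρ s * Real.exp (-1 * h s)) = Set.univ :=
      Set.eq_univ_of_forall fun s => (hwpos 1 s).ne'
    rw [this, Set.univ_inter]
    exact hV'o.measure_pos volume ⟨s₀, by simpa [hV', h0] using half_pos hδ⟩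
  set N₁ := ∫ s, ρ s * Real.exp (-1 * h s) * G s with hN₁
  have hN₁nn : 0 ≤ N₁ := integral_nonneg fun s => mul_nonneg (hwpos 1 s).le (hGnn s)
  have hdecay : Tendsto (fun M : ℝ => Real.exp (-((M - 1) * (δ / 2))) * (N₁ / κ)) atTop (𝓝 0) := by
    have h1 : Tendsto (fun M : ℝ => (M - 1) * (δ / 2)) atTop atTop :=
      (tendsto_atTop_add_const_right _ (-1) tendsto_id).atTop_mul_const (half_pos hδ)
    simpa using (Real.tendsto_exp_neg_atTop_nhds_zero.comp h1).mul_const (N₁ / κ)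
  filter_upwards [eventually_ge_atTop 1, hdecay.eventually_lt_const (half_pos hε)] with M hM hsmall
  have hM0 : 0 < M := one_pos.trans_le hM
  set D := ∫ s, ρ s * Real.exp (-M * h s)
  set N := ∫ s, ρ s * Real.exp (-M * h s) * G s
  have hNnn : 0 ≤ N := integral_nonneg fun s => mul_nonneg (hwpos M s).le (hGnn s)
  -- The denominator is at least `E κ`, while the part of the numerator where `G ≥ ε / 2` is at most
  -- `E² N₁`. Their quotient `E N₁ / κ` tends to `0`.
  set E := Real.exp (-((M - 1) * (δ / 2))) with hE
  have hEpos : 0 < E := Real.exp_pos _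
  have hexp : ∀ s, Real.exp (-M * h s) = Real.exp (-((M - 1) * h s)) * Real.exp (-1 * h s) :=
    fun s => by rw [← Real.exp_add]; congr 1; ring
  have hD : E * κ ≤ D := by
    rw [hκ, ← integral_const_mul]
    refine (setIntegral_mono_on ((hi 1 one_pos).integrableOn.const_mul E) (hi M hM0).integrableOn
      hV'o.measurableSet fun s hs => ?_).trans
      (setIntegral_le_integral (hi M hM0) (Eventually.of_forall fun s => (hwpos M s).le))
    have h1 : E ≤ Real.exp (-((M - 1) * h s)) := Real.exp_le_exp.2 <| neg_le_neg <|
      mul_le_mul_of_nonneg_left (le_of_lt hs) (by linarith)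
    rw [hexp s]
    have := mul_le_mul_of_nonneg_left h1 (hwpos 1 s).le
    nlinarith
  have hDpos : 0 < D := (mul_pos hEpos hκpos).trans_le hD
  have hN : N ≤ ε / 2 * D + E * E * N₁ := by
    rw [hN₁, ← integral_const_mul, ← integral_const_mul,
      ← integral_add ((hi M hM0).const_mul _) ((hiG 1 one_pos).const_mul _)]
    refine integral_mono (hiG M hM0) (((hi M hM0).const_mul _).add
      ((hiG 1 one_pos).const_mul _)) fun s => ?_
    dsimp only
    by_cases hs : s ∈ {s | G s < ε / 2}
    · have h1 := mul_le_mul_of_nonneg_left (le_of_lt hs) (hwpos M s).le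
      have h2 := mul_nonneg (mul_pos hEpos hEpos).le (mul_nonneg (hwpos 1 s).le (hGnn s))
      linarith
    · have h1 : Real.exp (-((M - 1) * h s)) ≤ E * E := by
        rw [hE, ← Real.exp_add, Real.exp_le_exp]
        have := mul_le_mul_of_nonneg_left (hδV s hs) (by linarith : 0 ≤ M - 1)
        linarith
      have h2 := mul_le_mul_of_nonneg_right h1 (mul_nonneg (hwpos 1 s).le (hGnn s))
      have h3 := mul_nonneg (half_pos hε).le (hwpos M s).le
      rw [hexp s] at h3 ⊢
      linarith
  rw [Real.dist_eq, sub_zero, abs_of_nonneg (div_nonneg hNnn hDpos.le), div_lt_iff₀ hDpos]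
  have h4 : E * E * N₁ < ε / 2 * D := by
    have h5 : E * N₁ < ε / 2 * κ := by
      rwa [← mul_div_assoc, div_lt_iff₀ hκpos] at hsmall
    have h6 := mul_lt_mul_of_pos_left h5 hEpos
    have h7 := mul_le_mul_of_nonneg_left hD (half_pos hε).le
    linarith
  linarith

end Laplace

/-! ### The small noise limit of the mean velocity. -/

section Limit

variable {n : ℕ} {u₀ : Vec n → Vec n} {ρ₀ : Vec n → ℝ}

lemma measureReal_explicitDensity (v c b t : ℝ) (hu₀ : Continuous u₀) (x : Vec n)
    [IsFiniteMeasure (startMeasure u₀ ρ₀ v t x)] :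
    (explicitDensity u₀ ρ₀ v c b t x).real Set.univ =
      (startMeasure u₀ ρ₀ v t x).real Set.univ := by
  rw [explicitDensity, map_measureReal_apply (continuous_arrival hu₀ c b t x).measurable
    MeasurableSet.univ, Set.preimage_univ, ← Set.univ_prod_univ, measureReal_prod_prod]
  simp

lemma measureReal_startMeasure_pos (hu₀ : Continuous u₀) {C : ℝ} (hC : ∀ x, ‖u₀ x‖ ≤ C)
    (hρ₀ : Continuous ρ₀) {D : ℝ} (hD : ∀ x, ρ₀ x ≤ D) (hpos : ∀ x, 0 < ρ₀ x) {t : ℝ} (ht : 0 ≤ t)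
    {v : ℝ} (hv : 0 < v) (x : Vec n) : 0 < (startMeasure u₀ ρ₀ v t x).real Set.univ := by
  have hw : ∀ s, 0 < ρ₀ s * gaussDensity n v (x - flow u₀ t s) := fun s =>
    mul_pos (hpos s) (gaussDensity_pos hv _)
  have h1 := integral_startMeasure hu₀ hρ₀ hpos hv t x fun _ => (1 : ℝ)
  rw [integral_const, smul_eq_mul, mul_one] at h1
  rw [h1]
  simp only [smul_eq_mul, mul_one]
  rw [integral_pos_iff_support_of_nonneg (fun s => (hw s).le)
    (integrable_gaussWeight hu₀ hC hρ₀ hD hpos ht hv x)]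
  have : Function.support (fun s => ρ₀ s * gaussDensity n v (x - flow u₀ t s)) = Set.univ :=
    Set.eq_univ_of_forall fun s => (hw s).ne'
  rw [this]
  exact isOpen_univ.measure_pos volume Set.univ_nonempty

lemma integrable_arrival (hu₀ : Continuous u₀) {C : ℝ} (hC : ∀ x, ‖u₀ x‖ ≤ C)
    (hρ₀ : Continuous ρ₀) {D : ℝ} (hD : ∀ x, ρ₀ x ≤ D) (hpos : ∀ x, 0 < ρ₀ x) {t : ℝ} (ht : 0 ≤ t)
    {v : ℝ} (hv : 0 < v) (c : ℝ) (x : Vec n) :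
    Integrable (fun s => u₀ s + c • (x - flow u₀ t s)) (startMeasure u₀ ρ₀ v t x) := by
  have := isFiniteMeasure_startMeasure hu₀ hC hρ₀ hD hpos ht hv x
  have hf := continuous_flow hu₀ t
  have h1 : Integrable (fun s => x - flow u₀ t s) (startMeasure u₀ ρ₀ v t x) :=
    (integrable_norm_iff (by fun_prop : Continuous _).aestronglyMeasurable).1
      (integrable_norm_startMeasure hu₀ hC hρ₀ hD hpos ht hv x)
  exact (Integrable.of_bound hu₀.aestronglyMeasurable C (Eventually.of_forall hC)).add
    (h1.smul c)

lemma integrable_id_explicitDensity (hu₀ : Continuous u₀) {C : ℝ} (hC : ∀ x, ‖u₀ x‖ ≤ C)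
    (hρ₀ : Continuous ρ₀) {D : ℝ} (hD : ∀ x, ρ₀ x ≤ D) (hpos : ∀ x, 0 < ρ₀ x) {t : ℝ} (ht : 0 ≤ t)
    {v : ℝ} (hv : 0 < v) (c b : ℝ) (x : Vec n) :
    Integrable (fun u => u) (explicitDensity u₀ ρ₀ v c b t x) := by
  have := isFiniteMeasure_startMeasure hu₀ hC hρ₀ hD hpos ht hv x
  rw [explicitDensity, integrable_map_measure (by fun_prop)
    (continuous_arrival hu₀ c b t x).measurable.aemeasurable]
  exact ((integrable_arrival hu₀ hC hρ₀ hD hpos ht hv c x).comp_fst _).add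
    (((IsGaussian.integrable_fun_id (μ := stdGaussian (Vec n))).comp_snd _).smul b)

/-- The residual noise `b z` is centred and independent of the starting point, so it drops out of
the mean. -/
lemma integral_id_explicitDensity (hu₀ : Continuous u₀) {C : ℝ} (hC : ∀ x, ‖u₀ x‖ ≤ C)
    (hρ₀ : Continuous ρ₀) {D : ℝ} (hD : ∀ x, ρ₀ x ≤ D) (hpos : ∀ x, 0 < ρ₀ x) {t : ℝ} (ht : 0 ≤ t)
    {v : ℝ} (hv : 0 < v) (c b : ℝ) (x : Vec n) :
    ∫ u, u ∂explicitDensity u₀ ρ₀ v c b t x =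
      ∫ s, u₀ s + c • (x - flow u₀ t s) ∂startMeasure u₀ ρ₀ v t x := by
  have := isFiniteMeasure_startMeasure hu₀ hC hρ₀ hD hpos ht hv x
  have h1 := (integrable_arrival hu₀ hC hρ₀ hD hpos ht hv c x).comp_fst (stdGaussian (Vec n))
  have h2 := (((IsGaussian.integrable_fun_id (μ := stdGaussian (Vec n))).comp_snd
    (startMeasure u₀ ρ₀ v t x)).smul b)
  rw [explicitDensity, integral_map (continuous_arrival hu₀ c b t x).measurable.aemeasurable
    (by fun_prop)]
  refine (integral_add h1 h2).trans ?_
  have h3 : ∫ q, (b • fun q : Vec n × Vec n => q.2) q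
      ∂(startMeasure u₀ ρ₀ v t x).prod (stdGaussian (Vec n)) = 0 := by
    simp only [Pi.smul_apply]
    rw [integral_smul, integral_fun_snd (μ := startMeasure u₀ ρ₀ v t x)
      (ν := stdGaussian (Vec n)) fun z => z, integral_id_stdGaussian, smul_zero, smul_zero]
  rw [h3, add_zero, integral_fun_fst (μ := startMeasure u₀ ρ₀ v t x)
    (ν := stdGaussian (Vec n)) fun s => u₀ s + c • (x - flow u₀ t s)]
  simp

/-- The squared distance of `x` to the endpoint of the flow has a strict minimum. -/
lemma exists_le_sq_norm_sub_flow (hu₀ : Continuous u₀) {C : ℝ} (hC : ∀ x, ‖u₀ x‖ ≤ C)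
    {t : ℝ} (ht : 0 ≤ t) {x s₀ : Vec n} (huniq : ∀ s, flow u₀ t s = x → s = s₀) :
    ∀ V ∈ 𝓝 s₀, ∃ δ > 0, ∀ s ∉ V, δ ≤ ‖x - flow u₀ t s‖ ^ 2 := by
  intro V hV
  have hf := continuous_flow hu₀ t
  -- Outside the ball of radius `R` the flow ends at distance at least `1` from `x`; inside,
  -- compactness gives a positive minimum away from `s₀`.
  set R := ‖x‖ + t * C + 1
  have hcompact : IsCompact (Metric.closedBall (0 : Vec n) R ∩ (interior V)ᶜ) :=
    (isCompact_closedBall _ _).inter_right isOpen_interior.isClosed_compl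
  obtain ⟨δ, hδ, hle⟩ := hcompact.exists_forall_le' (f := fun s => ‖x - flow u₀ t s‖ ^ 2)
    (by fun_prop) (a := 0) fun s hs => by
      have hne : x - flow u₀ t s ≠ 0 := fun h0 => hs.2 <| by
        rw [huniq s (sub_eq_zero.1 h0).symm]
        exact mem_interior_iff_mem_nhds.2 hV
      have := norm_pos_iff.2 hne
      positivity
  refine ⟨min δ 1, lt_min hδ one_pos, fun s hs => ?_⟩
  by_cases hsR : ‖s‖ ≤ R
  · exact (min_le_left _ _).trans
      (hle s ⟨mem_closedBall_zero_iff.2 hsR, fun h => hs (interior_subset h)⟩)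
  · refine (min_le_right _ _).trans ?_
    have h1 := norm_le_norm_sub_flow_add hC ht x s
    have h2 : 1 ≤ ‖x - flow u₀ t s‖ := by linarith
    nlinarith

lemma tendsto_inv_posVar {t : ℝ} (ht : 0 < t) :
    Tendsto (fun σ => (2 * posVar σ t)⁻¹) (𝓝[admissible] 0) atTop := by
  refine tendsto_inv_nhdsGT_zero.comp (tendsto_nhdsWithin_iff.2 ⟨?_, ?_⟩)
  · have hc : Continuous fun σ : ℝ × ℝ => 2 * posVar σ t := by
      unfold posVar
      fun_prop
    have := hc.tendsto 0
    simp only [posVar, Prod.fst_zero, Prod.snd_zero] at this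
    norm_num at this
    exact this.mono_left nhdsWithin_le_nhds
  · filter_upwards [self_mem_nhdsWithin] with σ hσ
    exact mul_pos two_pos (posVar_pos hσ.2.2 ht)

/-- The mean velocity of the particles that arrive at `x` converges to that of the only
characteristic through `x`. -/
theorem tendsto_mean_explicitDensity (hu₀ : Continuous u₀) {C : ℝ} (hC : ∀ x, ‖u₀ x‖ ≤ C)
    (hρ₀ : Continuous ρ₀) {D : ℝ} (hD : ∀ x, ρ₀ x ≤ D) (hpos : ∀ x, 0 < ρ₀ x) {t : ℝ} (ht : 0 < t)
    {x s₀ : Vec n} (hs₀ : ∀ s, flow u₀ t s = x ↔ s = s₀) :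
    Tendsto (fun σ : ℝ × ℝ =>
      ((explicitDensity u₀ ρ₀ (posVar σ t) (regCoeff σ t) (resDev σ t) t x).real Set.univ)⁻¹ •
        ∫ u, u ∂explicitDensity u₀ ρ₀ (posVar σ t) (regCoeff σ t) (resDev σ t) t x)
      (𝓝[admissible] 0) (𝓝 (u₀ s₀)) := by
  have hf := continuous_flow hu₀ t
  set K := 3 / (2 * t)
  have hK : 0 ≤ K := by positivity
  -- `G` bounds the deviation of the mean arrival velocity from `u₀ s₀`. Replacing `c` by its bound
  -- `K` makes `G` independent of `σ`, so the Laplace limit applies with `M = (2 posVar)⁻¹` as the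
  -- only parameter.
  let G : Vec n → ℝ := fun s => ‖u₀ s - u₀ s₀‖ + K * ‖x - flow u₀ t s‖
  have hG : Continuous G := by fun_prop
  have hGnn : ∀ s, 0 ≤ G s := fun s => by positivity
  have hi : ∀ M : ℝ, 0 < M → Integrable fun s => ρ₀ s * Real.exp (-M * ‖x - flow u₀ t s‖ ^ 2) :=
    fun M hM => integrable_weight hu₀ hC hρ₀ hD hpos ht.le hM x
  have hiG : ∀ M : ℝ, 0 < M →
      Integrable fun s => ρ₀ s * Real.exp (-M * ‖x - flow u₀ t s‖ ^ 2) * G s := by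
    intro M hM
    have h1 := (hi M hM).mul_bdd (c := 2 * C) (g := fun s => ‖u₀ s - u₀ s₀‖)
      (by fun_prop : Continuous _).aestronglyMeasurable (Eventually.of_forall fun s => by
        rw [norm_norm]
        have := norm_sub_le (u₀ s) (u₀ s₀)
        linarith [hC s, hC s₀])
    have h2 := (integrable_weight_mul_norm hu₀ hC hρ₀ hD hpos ht.le hM x).const_mul K
    refine (h1.add h2).congr (Eventually.of_forall fun s => ?_)
    simp only [Pi.add_apply, G]
    ring
  have hflow : flow u₀ t s₀ = x := (hs₀ s₀).2 rfl
  have hratio := tendsto_laplace_ratio (h := fun s => ‖x - flow u₀ t s‖ ^ 2) (ρ := ρ₀) (G := G)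
    (s₀ := s₀) (by fun_prop) (by simp [hflow])
    (exists_le_sq_norm_sub_flow hu₀ hC ht.le fun s => (hs₀ s).1) hpos hG hGnn
    (by simp [G, hflow]) hi hiG
  rw [tendsto_iff_norm_sub_tendsto_zero]
  refine squeeze_zero' (Eventually.of_forall fun _ => norm_nonneg _) ?_
    (hratio.comp (tendsto_inv_posVar ht))
  filter_upwards [self_mem_nhdsWithin] with σ hσ
  have hv := posVar_pos hσ.2.2 ht
  set v := posVar σ t
  set c := regCoeff σ t
  have := isFiniteMeasure_startMeasure hu₀ hC hρ₀ hD hpos ht.le hv x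
  have hmass := measureReal_startMeasure_pos hu₀ hC hρ₀ hD hpos ht.le hv x
  rw [measureReal_explicitDensity _ _ _ _ hu₀,
    integral_id_explicitDensity hu₀ hC hρ₀ hD hpos ht.le hv]
  set m := startMeasure u₀ ρ₀ v t x with hm
  have hdiff : (m.real Set.univ)⁻¹ • ∫ s, u₀ s + c • (x - flow u₀ t s) ∂m - u₀ s₀ =
      (m.real Set.univ)⁻¹ • ∫ s, (u₀ s + c • (x - flow u₀ t s) - u₀ s₀) ∂m := by
    rw [integral_sub (integrable_arrival hu₀ hC hρ₀ hD hpos ht.le hv c x) (integrable_const _),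
      integral_const, smul_sub, smul_smul, inv_mul_cancel₀ hmass.ne', one_smul]
  rw [hdiff, norm_smul, norm_inv, Real.norm_of_nonneg hmass.le]
  have hM : 0 < (2 * v)⁻¹ := by positivity
  set k : ℝ := (Real.pi / (2 * v)⁻¹) ^ (-(n : ℝ) / 2) with hk
  have hkpos : 0 < k := by positivity
  have hden : m.real Set.univ =
      k * ∫ s, ρ₀ s * Real.exp (-(2 * v)⁻¹ * ‖x - flow u₀ t s‖ ^ 2) := by
    have h1 := integral_startMeasure hu₀ hρ₀ hpos hv t x fun _ => (1 : ℝ)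
    rw [integral_const, smul_eq_mul, mul_one] at h1
    rw [hm, h1, ← integral_const_mul]
    refine integral_congr_ae (Eventually.of_forall fun s => ?_)
    simp only [smul_eq_mul, gaussDensity, ← hk]
    ring
  have hnum : ∫ s, G s ∂m =
      k * ∫ s, ρ₀ s * Real.exp (-(2 * v)⁻¹ * ‖x - flow u₀ t s‖ ^ 2) * G s := by
    rw [hm, integral_startMeasure hu₀ hρ₀ hpos hv, ← integral_const_mul]
    refine integral_congr_ae (Eventually.of_forall fun s => ?_)
    simp only [smul_eq_mul, gaussDensity, ← hk]
    ring
  have hGint : Integrable G m :=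
    (Integrable.of_bound (by fun_prop) (2 * C) (Eventually.of_forall fun s => by
      rw [norm_norm]
      have := norm_sub_le (u₀ s) (u₀ s₀)
      linarith [hC s, hC s₀])).add
      ((integrable_norm_startMeasure hu₀ hC hρ₀ hD hpos ht.le hv x).const_mul K)
  have hle : ‖∫ s, (u₀ s + c • (x - flow u₀ t s) - u₀ s₀) ∂m‖ ≤ ∫ s, G s ∂m := by
    refine norm_integral_le_of_norm_le hGint (Eventually.of_forall fun s => ?_)
    have h1 : u₀ s + c • (x - flow u₀ t s) - u₀ s₀ =
        (u₀ s - u₀ s₀) + c • (x - flow u₀ t s) := by abel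
    rw [h1]
    refine (norm_add_le _ _).trans (add_le_add_right ?_ _)
    rw [norm_smul, Real.norm_of_nonneg (regCoeff_nonneg hσ.2.2 ht)]
    exact mul_le_mul_of_nonneg_right (regCoeff_le hσ.2.2 ht) (norm_nonneg _)
  calc (m.real Set.univ)⁻¹ * ‖∫ s, (u₀ s + c • (x - flow u₀ t s) - u₀ s₀) ∂m‖
      ≤ (m.real Set.univ)⁻¹ * ∫ s, G s ∂m :=
        mul_le_mul_of_nonneg_left hle (inv_nonneg.2 hmass.le)
    _ = _ := by
      rw [hnum, hden, mul_inv, Function.comp_apply, div_eq_mul_inv, mul_mul_mul_comm,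
        inv_mul_cancel₀ hkpos.ne', one_mul]
      exact mul_comm _ _

end Limit

end StochasticBurgers

theorem proposition2p1 {n : ℕ}
    (u₀ : StochasticBurgers.Vec n → StochasticBurgers.Vec n) (hu₀ : ContDiff ℝ 1 u₀)
    (hu₀_bdd : ∃ C : ℝ, ∀ x, ‖u₀ x‖ ≤ C)
    (ρ₀ : StochasticBurgers.Vec n → ℝ) (hρ₀ : ContDiff ℝ 1 ρ₀)
    (hρ₀_bdd : ∃ C : ℝ, ∀ x, ρ₀ x ≤ C) (hρ₀_pos : ∀ x, 0 < ρ₀ x)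
    {Ω : Type*} [MeasurableSpace Ω] (μ : Measure Ω) [IsProbabilityMeasure μ]
    (W₁ W₂ : Fin n → ℝ≥0 → Ω → ℝ) (hW : StochasticBurgers.IsBrownianPair W₁ W₂ μ) :
    ∃ s₀ : ℝ → StochasticBurgers.Vec n → StochasticBurgers.Vec n,
      -- `s₀(t, x)` is the unique solution `s` of `u₀(s) t + s - x = 0`
      (∀ t : ℝ, 0 ≤ t → ENNReal.ofReal t < StochasticBurgers.lifespan u₀ →
        ∀ x s, t • u₀ s + s - x = 0 ↔ s = s₀ t x) ∧
      -- `u₀(s₀(t, x))` is the unique classical solution of the Burgers equation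
      StochasticBurgers.IsClassicalSolution u₀ (StochasticBurgers.lifespan u₀)
        (fun t x => u₀ (s₀ t x)) ∧
      (∀ (T : ℝ≥0∞) (u : ℝ → StochasticBurgers.Vec n → StochasticBurgers.Vec n),
        StochasticBurgers.IsClassicalSolution u₀ T u →
        ∀ t : ℝ, 0 ≤ t → ENNReal.ofReal t < T → ∀ x, u t x = u₀ (s₀ t x)) ∧
      ∀ t : ℝ, 0 < t → ENNReal.ofReal t < StochasticBurgers.lifespan u₀ →
        -- `u_σ(t, x)` is well defined
        (∀ σ ∈ StochasticBurgers.admissible,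
          (∃! P, StochasticBurgers.IsPhaseDensity
            (StochasticBurgers.jointLaw u₀ ρ₀ W₁ W₂ μ σ t) P) ∧
          ∀ x, 0 < StochasticBurgers.perturbedDensity u₀ ρ₀ W₁ W₂ μ σ t x ∧
            Integrable (fun u => u) (StochasticBurgers.phaseDensity
              (StochasticBurgers.jointLaw u₀ ρ₀ W₁ W₂ μ σ t) x)) ∧
        -- and converges to the classical solution as `|σ| → 0`
        ∀ x, Tendsto (fun σ => StochasticBurgers.perturbedVelocity u₀ ρ₀ W₁ W₂ μ σ t x)
          (𝓝[StochasticBurgers.admissible] 0) (𝓝 (u₀ (s₀ t x))) := by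
  obtain ⟨C, hC⟩ := hu₀_bdd
  obtain ⟨D, hD⟩ := hρ₀_bdd
  refine ⟨StochasticBurgers.footPoint u₀,
    fun t ht htT x s => StochasticBurgers.solves_iff_eq_footPoint hu₀ ht htT x s,
    StochasticBurgers.isClassicalSolution_footPoint hu₀ ⟨C, hC⟩,
    fun T u h t ht htT x => h.eq_footPoint hu₀ ht htT x, fun t ht htT => ?_⟩
  have hP := fun σ (hσ : σ ∈ StochasticBurgers.admissible) =>
    StochasticBurgers.isPhaseDensity_explicitDensity hu₀.continuous hC hρ₀.continuous hD hρ₀_pos hW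
      hσ.2.2 ht
  refine ⟨fun σ hσ => ⟨⟨_, hP σ hσ, fun P h => h.unique (hP σ hσ)⟩, fun x => ?_⟩, fun x => ?_⟩
  · have hv := StochasticBurgers.posVar_pos hσ.2.2 ht
    have := StochasticBurgers.isFiniteMeasure_startMeasure hu₀.continuous hC hρ₀.continuous hD
      hρ₀_pos ht.le hv x
    rw [StochasticBurgers.perturbedDensity, (hP σ hσ).phaseDensity_eq,
      StochasticBurgers.measureReal_explicitDensity _ _ _ _ hu₀.continuous]
    exact ⟨StochasticBurgers.measureReal_startMeasure_pos hu₀.continuous hC hρ₀.continuous hD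
      hρ₀_pos ht.le hv x, StochasticBurgers.integrable_id_explicitDensity hu₀.continuous hC
      hρ₀.continuous hD hρ₀_pos ht.le hv _ _ x⟩
  · refine (StochasticBurgers.tendsto_mean_explicitDensity hu₀.continuous hC hρ₀.continuous hD
      hρ₀_pos ht (x := x) (s₀ := StochasticBurgers.footPoint u₀ t x) fun s => ?_).congr' ?_
    · rw [← StochasticBurgers.solves_iff_eq_footPoint hu₀ ht.le htT x s, sub_eq_zero,
        StochasticBurgers.flow, add_comm]
    · filter_upwards [self_mem_nhdsWithin] with σ hσ
      rw [StochasticBurgers.perturbedVelocity, StochasticBurgers.perturbedDensity,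
        (hP σ hσ).phaseDensity_eq]
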